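/- **Setting.** Let $\mathcal X$ be a set of features, and let $\mathcal Y$ (labels) and $\tilde{\mathcal Y}$ (noisy observations) be finite sets with at least two elements each. Let $\mathcal D(\tilde{\mathcal Y})$ be the set of probability distributions on $\tilde{\mathcal Y}$. A *noisy kernel* $\mathcal K$ assigns to every $(x,y)\in\mathcal X\times\mathcal Y$ a nonempty closed convex set $\mathcal Q_y^x\subseteq\mathcal D(\tilde{\mathcal Y})$. For $p,q\in\mathcal D(\tilde{\mathcal Y})$ put $H^2(p,q)=\sum_{m}(\sqrt{p[m]}-\sqrt{q[m]})^2$, and for sets put $H^2(\mathcal P,\mathcal Q)=\inf_{p\in\mathcal P,\,q\in\mathcal Q}H^2(p,q)$. A *feature selector* is a sequence $\psi=(\psi_t)_{t=1}^{T}$ of maps $\psi_t:\tilde{\mathcal Y}^{t-1}\to\mathcal X$. For $A>0$ and $0\le\alpha<1$, the pair $(\mathcal K,\psi)$ satisfies the *soft constraint* if $$\forall r\in(0,1/2]:\qquad \frac1T\sum_{t=1}^T \mathbf 1\Big\{\inf_{\tilde y^{t-1}\in\tilde{\mathcal Y}^{t-1}}\ \inf_{y\ne y'\in\mathcal Y}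 H^2\big(\mathcal Q_y^{\psi_t(\tilde y^{t-1})},\mathcal Q_{y'}^{\psi_t(\tilde y^{t-1})}\big)\le r\Big\}\le A\,r^{\frac{\alpha}{1-\alpha}} .$$ For a class $\mathcal H\subseteq\mathcal Y^{\mathcal X}$, let $$\tilde r_T(\mathcal H,\mathcal K)=\inf_\Phi\ \sup_{h\in\mathcal H}\ \sup_{\psi}\ \sup_{\tilde p^T}\ \mathbb E\Big[\sum_{t=1}^T\mathbf 1\{h(x_t)\ne\hat y_t\}\Big],\qquad x_t=\psi_t(\tilde y^{t-1}),\quad \hat y_t\sim\Phi(x^t,\tilde y^{t-1}),$$ be the expected minimax risk under the soft constraint. Here $\Phi$ runs over the randomized learners (who may depend on $\mathcal K$, $\mathcal H$, $T$, $A$, $\alpha$, but not on $h$, $\psi$, $\tilde p^T$), $\psi$ runs over the feature selectors for which $(\mathcal K,\psi)$ satisfies the soft constraint, and $\tilde p^T$ runs over the laws of $\tilde y^T$ whose conditional law of $\tilde y_t$ given $\tilde y^{t-1}$ always lies in $\mathcal Q_{h(x_t)}^{x_t}$. Put $$R_T(K)=\sup_{\mathcal K}\ \sup_{\mathcal H:\,|\mathcal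 H|\le K}\tilde r_T(\mathcal H,\mathcal K),$$ where $\mathcal K$ runs over the kernels for which some feature selector satisfies the soft constraint. **Proposition.** Let $A>0$ and $0\le\alpha<1$. There are constants $c,C>0$ and $d\in\mathbb N$, depending only on $A$ and $\alpha$, such that for all $\mathcal X,\mathcal Y,\tilde{\mathcal Y}$ as above and all integers $T\ge1$ and $K\ge2$: 1. $R_T(K)\le C\,\big((1+\log T)(1+\log K)\big)^{d}\,T^{1-\alpha}$. 2. If $|\mathcal X|\ge2$ and at least one kernel has a feature selector satisfying the soft constraint (this always holds, for instance, when $|\mathcal Y|\le|\tilde{\mathcal Y}|$), then $R_T(K)\ge c\,\dfrac{T^{1-\alpha}}{\big((1+\log T)(1+\log K)\big)^{d}}$. In other words, $R_T(K)=\tilde\Theta(T^{1-\alpha})$, where $\tilde\Theta$ hides factors polylogarithmic in $T$ and $K$. -/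

import Mathlib

open scoped ENNReal

universe u v w

noncomputable section

/-- A noisy kernel with features `X`, labels `Y` and noisy observations `Z`: it assigns to each
`(x, y)` a nonempty closed convex set of probability distributions on `Z`. -/
structure NoisyKernel (X Y Z : Type*) [Fintype Z] where
  Q : X → Y → Set (Z → ℝ)
  subset_simplex : ∀ x y, Q x y ⊆ stdSimplex ℝ Z
  nonempty : ∀ x y, (Q x y).Nonempty
  convex : ∀ x y, Convex ℝ (Q x y)
  closed : ∀ x y, IsClosed (Q x y)

/-- Squared Hellinger distance `∑ₘ (√p[m] - √q[m])²`. -/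
def hellingerSq {Z : Type*} [Fintype Z] (p q : Z → ℝ) : ℝ :=
  ∑ m, (Real.sqrt (p m) - Real.sqrt (q m)) ^ 2

/-- Squared Hellinger distance between two sets of distributions. -/
def hellingerSqSet {Z : Type*} [Fintype Z] (P Q : Set (Z → ℝ)) : ℝ≥0∞ :=
  ⨅ p ∈ P, ⨅ q ∈ Q, ENNReal.ofReal (hellingerSq p q)

/-- The Hellinger gap of the kernel at the feature `x`: the infimum over distinct labels. -/
def NoisyKernel.gap {X Y Z : Type*} [Fintype Z] (𝒦 : NoisyKernel X Y Z) (x : X) : ℝ≥0∞ :=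
  ⨅ (y : Y) (y' : Y) (_ : y ≠ y'), hellingerSqSet (𝒦.Q x y) (𝒦.Q x y')

/-- A feature selector. Times are counted from `0`: the feature presented at time `t` is a function
of the `t` noisy labels observed before. -/
abbrev FeatureSelector (X Z : Type*) := (t : ℕ) → (Fin t → Z) → X

/-- The adversary's conditional noisy label distributions: at time `t`, given the `t` previous noisy
labels, the distribution of the next one. -/
abbrev NoiseSelector (Z : Type*) := (t : ℕ) → (Fin t → Z) → (Z → ℝ)

/-- A randomized learner: at time `t` it sees the features at times `0, …, t` and the `t` previous
noisy labels, and draws its prediction from the distribution `Φ.predict t` on labels. -/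
structure Learner (X Y Z : Type*) [Fintype Y] where
  predict : (t : ℕ) → (Fin (t + 1) → X) → (Fin t → Z) → (Y → ℝ)
  mem_simplex : ∀ t xs zs, predict t xs zs ∈ stdSimplex ℝ Y

/-- The first `n` entries of a sequence of length `T`. -/
def pastLabels {Z : Type*} {T : ℕ} (z : Fin T → Z) (n : ℕ) (hn : n ≤ T) : Fin n → Z :=
  fun j => z (Fin.castLE hn j)

/-- The feature presented at time `t` when the noisy labels are `z`. -/
def featureAt {X Z : Type*} {T : ℕ} (ψ : FeatureSelector X Z) (z : Fin T → Z) (t : Fin T) : X :=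
  ψ t (pastLabels z t t.isLt.le)

/-- The features presented at times `0, …, t` when the noisy labels are `z`. -/
def featuresUpTo {X Z : Type*} {T : ℕ} (ψ : FeatureSelector X Z) (z : Fin T → Z) (t : Fin T) :
    Fin (t + 1) → X :=
  fun i => featureAt ψ z (Fin.castLE t.isLt i)

/-- The adversary may use `p` against the truth `h` and the selector `ψ` during `T` rounds: each
conditional distribution lies in the kernel set of the current feature and its true label. -/
def IsAdmissibleNoise {X Y Z : Type*} [Fintype Z] (𝒦 : NoisyKernel X Y Z) (T : ℕ) (h : X → Y)
    (ψ : FeatureSelector X Z) (p : NoiseSelector Z) : Prop :=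
  ∀ t < T, ∀ zs : Fin t → Z, p t zs ∈ 𝒦.Q (ψ t zs) (h (ψ t zs))

/-- The probability of the sequence `z` of noisy labels under the conditional distributions `p`. -/
def labelProb {Z : Type*} {T : ℕ} (p : NoiseSelector Z) (z : Fin T → Z) : ℝ :=
  ∏ t : Fin T, p t (pastLabels z t t.isLt.le) (z t)

open Classical in
/-- The expected number of prediction errors in `T` rounds, over the noisy labels and the learner's
randomization: the sum over `t` of the probabilities that the prediction at time `t` differs from
the true label. -/
def expectedErrors {X Y Z : Type*} [Fintype Y] [Fintype Z] (T : ℕ) (Φ : Learner X Y Z) (h : X → Y)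
    (ψ : FeatureSelector X Z) (p : NoiseSelector Z) : ℝ :=
  ∑ z : Fin T → Z, labelProb p z * ∑ t : Fin T, ∑ y : Y,
    Φ.predict t (featuresUpTo ψ z t) (pastLabels z t t.isLt.le) y *
      (if h (featureAt ψ z t) ≠ y then 1 else 0)

/-- The expected minimax risk over `T` rounds of the class `H` under the kernel `𝒦`, against an
adversary whose feature selector is restricted to the set `S` (and is unknown to the learner). -/
def expectedMinimaxRisk {X Y Z : Type*} [Fintype Y] [Fintype Z] (𝒦 : NoisyKernel X Y Z)
    (H : Set (X → Y)) (T : ℕ) (S : Set (FeatureSelector X Z)) : ℝ≥0∞ :=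
  ⨅ Φ : Learner X Y Z, ⨆ h ∈ H, ⨆ ψ ∈ S, ⨆ (p : NoiseSelector Z)
    (_ : IsAdmissibleNoise 𝒦 T h ψ p), ENNReal.ofReal (expectedErrors T Φ h ψ p)

open Classical in
/-- The soft Hellinger-gap constraint with parameters `A`, `α` over `T` rounds: for each
`r ∈ (0, 1/2]`, the fraction of the times `t` at which the least gap over all histories is at most
`r` does not exceed `A r^{α/(1-α)}`. -/
def SoftGap {X Y Z : Type*} [Fintype Z] (A α : ℝ) (T : ℕ) (𝒦 : NoisyKernel X Y Z)
    (ψ : FeatureSelector X Z) : Prop :=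
  ∀ r : ℝ, 0 < r → r ≤ 1 / 2 →
    (1 / (T : ℝ)) * ∑ t ∈ Finset.range T,
        (if (⨅ zs : Fin t → Z, 𝒦.gap (ψ t zs)) ≤ ENNReal.ofReal r then (1 : ℝ) else 0)
      ≤ A * r ^ (α / (1 - α))

/-- The kernels for which some feature selector satisfies the soft constraint. -/
def softKernels (X Y Z : Type*) [Fintype Z] (A α : ℝ) (T : ℕ) : Set (NoisyKernel X Y Z) :=
  {𝒦 | ∃ ψ : FeatureSelector X Z, SoftGap A α T 𝒦 ψ}

/-- The worst-case expected minimax risk under the soft constraint, over all such kernels and all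
classes of at most `K` hypotheses. -/
def softWorstRisk (X Y Z : Type*) [Fintype Y] [Fintype Z] (A α : ℝ) (T K : ℕ) : ℝ≥0∞ :=
  ⨆ 𝒦 ∈ softKernels X Y Z A α T, ⨆ (H : Finset (X → Y)) (_ : H.card ≤ K),
    expectedMinimaxRisk 𝒦 (H : Set (X → Y)) T {ψ | SoftGap A α T 𝒦 ψ}

end

/-! ### Sums over sequences of noisy labels -/

lemma pastLabels_snoc {Z : Type*} {T : ℕ} (z : Fin T → Z) (m : Z) (n : ℕ) (hn : n ≤ T) :
    pastLabels (Fin.snoc z m : Fin (T + 1) → Z) n (hn.trans (Nat.le_succ T)) =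
      pastLabels z n hn := by
  funext j
  have : Fin.castLE (hn.trans (Nat.le_succ T)) j = (Fin.castLE hn j).castSucc := by ext; simp
  simp only [pastLabels, this, Fin.snoc_castSucc]

lemma labelProb_snoc {Z : Type*} {T : ℕ} (q : NoiseSelector Z) (z : Fin T → Z) (m : Z) :
    labelProb q (Fin.snoc z m : Fin (T + 1) → Z) = labelProb q z * q T z m := by
  unfold labelProb
  rw [Fin.prod_univ_castSucc]
  congr 1
  · refine Finset.prod_congr rfl fun t _ => ?_
    rw [Fin.snoc_castSucc]
    exact congrArg (fun f => q t f (z t)) (pastLabels_snoc z m t t.isLt.le)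
  · rw [Fin.snoc_last]
    refine congrArg (fun f => q T f m) ?_
    exact pastLabels_snoc z m T le_rfl

lemma sum_snoc {Z : Type*} [Fintype Z] {T : ℕ} (f : (Fin (T + 1) → Z) → ℝ) :
    ∑ z, f z = ∑ z : Fin T → Z, ∑ m : Z, f (Fin.snoc z m) := by
  rw [← (Fin.snocEquiv (fun _ : Fin (T + 1) => Z)).sum_comp, Fintype.sum_prod_type,
    Finset.sum_comm]
  rfl

lemma labelProb_nonneg {Z : Type*} {T : ℕ} {q : NoiseSelector Z}
    (h0 : ∀ t < T, ∀ zs m, 0 ≤ q t zs m) (z : Fin T → Z) : 0 ≤ labelProb q z :=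
  Finset.prod_nonneg fun t _ => h0 t t.isLt _ _

/-- Subprobability conditionals are allowed so that evidence can be absorbed into the conditional
laws, which replaces a supermartingale argument. -/
lemma sum_labelProb_le_one {Z : Type*} [Fintype Z] {T : ℕ} {q : NoiseSelector Z}
    (h0 : ∀ t < T, ∀ zs m, 0 ≤ q t zs m) (h1 : ∀ t < T, ∀ zs, ∑ m, q t zs m ≤ 1) :
    ∑ z : Fin T → Z, labelProb q z ≤ 1 := by
  induction T with
  | zero => simp [labelProb]
  | succ T ih =>
    rw [sum_snoc]
    simp only [labelProb_snoc, ← Finset.mul_sum]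
    refine le_trans (Finset.sum_le_sum fun z _ => ?_)
      (ih (fun t ht => h0 t (ht.trans T.lt_succ_self)) fun t ht => h1 t (ht.trans T.lt_succ_self))
    exact mul_le_of_le_one_right
      (labelProb_nonneg (fun t ht => h0 t (ht.trans T.lt_succ_self)) z) (h1 T T.lt_succ_self z)

lemma sum_labelProb_eq_one {Z : Type*} [Fintype Z] {T : ℕ} {q : NoiseSelector Z}
    (h1 : ∀ t < T, ∀ zs, ∑ m, q t zs m = 1) :
    ∑ z : Fin T → Z, labelProb q z = 1 := by
  induction T with
  | zero => simp [labelProb]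
  | succ T ih =>
    rw [sum_snoc]
    simp only [labelProb_snoc, ← Finset.mul_sum, h1 T T.lt_succ_self, mul_one]
    exact ih fun t ht => h1 t (ht.trans T.lt_succ_self)

/-! ### Tests between convex sets of distributions -/

lemma le_one_of_mem_stdSimplex {Z : Type*} [Fintype Z] {p : Z → ℝ} (hp : p ∈ stdSimplex ℝ Z)
    (m : Z) : p m ≤ 1 :=
  hp.2 ▸ Finset.single_le_sum (f := p) (fun i _ => hp.1 i) (Finset.mem_univ m)

lemma hellingerSq_eq {Z : Type*} [Fintype Z] {p q : Z → ℝ} (hp : p ∈ stdSimplex ℝ Z)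
    (hq : q ∈ stdSimplex ℝ Z) : hellingerSq p q = 2 - 2 * ∑ m, √(p m * q m) := by
  have h : ∀ m, (√(p m) - √(q m)) ^ 2 = p m + q m - 2 * √(p m * q m) := fun m => by
    rw [sub_sq, Real.sq_sqrt (hp.1 m), Real.sq_sqrt (hq.1 m), Real.sqrt_mul (hp.1 m)]; ring
  simp only [hellingerSq, h, Finset.sum_sub_distrib, Finset.sum_add_distrib, hp.2, hq.2,
    ← Finset.mul_sum]
  ring

lemma sqrt_add_le_add_sqrt {a b : ℝ} (ha : 0 ≤ a) (hb : 0 ≤ b) : √(a + b) ≤ √a + √b := by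
  refine Real.sqrt_le_iff.2 ⟨by positivity, ?_⟩
  nlinarith [Real.sq_sqrt ha, Real.sq_sqrt hb, mul_nonneg (Real.sqrt_nonneg a) (Real.sqrt_nonneg b)]

/-- First-order optimality for the affinity `∑ₘ √((pₘ + ε) bₘ)` at a maximizer over a convex set. -/
lemma sum_mul_sqrt_div_le {Z : Type*} [Fintype Z] {P : Set (Z → ℝ)} (hP : Convex ℝ P)
    (h0 : ∀ p ∈ P, ∀ m, 0 ≤ p m) {ε : ℝ} (hε : 0 < ε) {b : Z → ℝ} (hb : ∀ m, 0 < b m)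
    {p₀ : Z → ℝ} (hp₀ : p₀ ∈ P)
    (hmax : ∀ p ∈ P, ∑ m, √((p m + ε) * b m) ≤ ∑ m, √((p₀ m + ε) * b m))
    {p : Z → ℝ} (hp : p ∈ P) :
    ∑ m, p m * √(b m / (p₀ m + ε)) ≤ ∑ m, √((p₀ m + ε) * b m) := by
  have hpos : ∀ q ∈ P, ∀ m, 0 < q m + ε := fun q hq m => by linarith [h0 q hq m]
  -- `F t` is the difference quotient of the affinity along the segment from `p₀` to `p`,
  -- rationalized so that it extends continuously to `t = 0`. The shift by `ε` keeps the
  -- denominators positive.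
  set F : ℝ → ℝ := fun t => ∑ m, √(b m) * (p m - p₀ m) /
    (√(p₀ m + t * (p m - p₀ m) + ε) + √(p₀ m + ε)) with hF
  have hcont : ContinuousAt F 0 := by
    refine tendsto_finsetSum _ fun m _ => ?_
    have hne : √(p₀ m + 0 * (p m - p₀ m) + ε) + √(p₀ m + ε) ≠ 0 :=
      (add_pos_of_nonneg_of_pos (Real.sqrt_nonneg _) (Real.sqrt_pos.2 (hpos p₀ hp₀ m))).ne'
    exact ContinuousAt.div (by fun_prop) (by fun_prop) hne
  have hle : ∀ t ∈ Set.Ioc (0 : ℝ) 1, F t ≤ 0 := by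
    intro t ht
    have hmem : p₀ + t • (p - p₀) ∈ P := hP.add_smul_sub_mem hp₀ hp ⟨ht.1.le, ht.2⟩
    have hm := hmax _ hmem
    have hz : ∑ m, √((p₀ m + ε) * b m) + t * F t =
        ∑ m, √(((p₀ + t • (p - p₀)) m + ε) * b m) := by
      rw [hF, Finset.mul_sum, ← Finset.sum_add_distrib]
      refine Finset.sum_congr rfl fun m _ => ?_
      have e1 : (p₀ + t • (p - p₀)) m + ε = p₀ m + t * (p m - p₀ m) + ε := by simp
      have h2 := hpos _ hmem m
      rw [e1] at h2 ⊢
      have h1 := hpos p₀ hp₀ m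
      rw [Real.sqrt_mul h1.le, Real.sqrt_mul h2.le]
      have s1 := Real.sqrt_pos.2 h1
      have s2 := Real.sqrt_pos.2 h2
      have q1 := Real.sq_sqrt h1.le
      have q2 := Real.sq_sqrt h2.le
      have : t * (p m - p₀ m) = √(p₀ m + t * (p m - p₀ m) + ε) ^ 2 - √(p₀ m + ε) ^ 2 := by
        rw [q1, q2]; ring
      have h3 : t * (√(b m) * (p m - p₀ m) /
          (√(p₀ m + t * (p m - p₀ m) + ε) + √(p₀ m + ε))) =
          √(b m) * (t * (p m - p₀ m)) /
          (√(p₀ m + t * (p m - p₀ m) + ε) + √(p₀ m + ε)) := by ring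
      rw [h3]
      generalize hs : √(p₀ m + t * (p m - p₀ m) + ε) = s at *
      rw [this]
      field_simp
      ring
    nlinarith [ht.1]
  have hlim : F 0 ≤ 0 := by
    refine le_of_tendsto (hcont.tendsto.mono_left (nhdsWithin_le_nhds (s := Set.Ioi 0))) ?_
    filter_upwards [Ioc_mem_nhdsGT (zero_lt_one' ℝ)] with t ht using hle t ht
  have hF0 : F 0 * 2 = ∑ m, p m * √(b m / (p₀ m + ε)) - ∑ m, p₀ m * √(b m / (p₀ m + ε)) := by
    rw [hF, ← Finset.sum_sub_distrib, Finset.sum_mul]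
    refine Finset.sum_congr rfl fun m _ => ?_
    have s1 := Real.sqrt_pos.2 (hpos p₀ hp₀ m)
    rw [Real.sqrt_div (hb m).le]
    simp only [zero_mul, add_zero]
    field_simp
    ring
  refine le_trans (sub_nonpos.1 (by linarith : ∑ m, p m * √(b m / (p₀ m + ε)) -
    ∑ m, p₀ m * √(b m / (p₀ m + ε)) ≤ 0)) (Finset.sum_le_sum fun m _ => ?_)
  have s1 := Real.sqrt_pos.2 (hpos p₀ hp₀ m)
  rw [Real.sqrt_div (hb m).le, Real.sqrt_mul (hpos p₀ hp₀ m).le, mul_div_assoc', div_le_iff₀ s1]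
  have : √(p₀ m + ε) * √(b m) * √(p₀ m + ε) = (p₀ m + ε) * √(b m) := by
    rw [mul_right_comm, Real.mul_self_sqrt (hpos p₀ hp₀ m).le]
  rw [this]
  exact mul_le_mul_of_nonneg_right (by linarith) (Real.sqrt_nonneg _)

/-- Two convex closed sets of distributions at squared Hellinger distance at least `r` are separated
by a likelihood-ratio test. -/
lemma exists_test {Z : Type*} [Fintype Z] {P Q : Set (Z → ℝ)} (hPs : P ⊆ stdSimplex ℝ Z)
    (hQs : Q ⊆ stdSimplex ℝ Z) (hPn : P.Nonempty) (hQn : Q.Nonempty) (hPc : Convex ℝ P)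
    (hQc : Convex ℝ Q) (hPcl : IsClosed P) (hQcl : IsClosed Q) {r : ℝ} (hr : 0 < r) (hr1 : r ≤ 1)
    (hgap : ∀ p ∈ P, ∀ q ∈ Q, r ≤ hellingerSq p q) :
    ∃ φ : Z → ℝ, (∀ m, 0 < φ m) ∧ (∀ p ∈ P, ∑ m, p m * φ m ≤ 1 - r / 4) ∧
      ∀ q ∈ Q, ∑ m, q m * (φ m)⁻¹ ≤ 1 - r / 4 := by
  set n : ℝ := Fintype.card Z + 1 with hn
  have hnpos : 0 < n := by positivity
  -- Since `(p + ε) * (q + ε) ≤ p * q + 3 * ε` for `p, q, ε ≤ 1`, smoothing raises the affinity by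
  -- at most `card Z * √(3 * ε) ≤ r / 4`, half of the available deficit `r / 2`.
  set ε : ℝ := (r / (4 * n)) ^ 2 / 3 with hεd
  have hε : 0 < ε := by positivity
  have hsq : √(3 * ε) = r / (4 * n) := by
    rw [hεd, mul_div_cancel₀ _ (by norm_num), Real.sqrt_sq (by positivity)]
  have hε1 : ε ≤ 1 := by
    have h1 : r / (4 * n) ≤ 1 := by
      rw [div_le_one (by positivity)]
      have : (0:ℝ) ≤ Fintype.card Z := by positivity
      rw [hn]; linarith
    have h2 : (r / (4 * n)) ^ 2 ≤ 1 := pow_le_one₀ (by positivity) h1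
    rw [hεd]; linarith
  have hcP : IsCompact P := (isCompact_stdSimplex ℝ Z).of_isClosed_subset hPcl hPs
  have hcQ : IsCompact Q := (isCompact_stdSimplex ℝ Z).of_isClosed_subset hQcl hQs
  obtain ⟨⟨p₀, q₀⟩, ⟨hp₀, hq₀⟩, hmax⟩ := (hcP.prod hcQ).exists_isMaxOn (hPn.prod hQn)
    (f := fun x : (Z → ℝ) × (Z → ℝ) => ∑ m, √((x.1 m + ε) * (x.2 m + ε)))
    (by fun_prop)
  simp only at hp₀ hq₀
  have hp0 : ∀ p ∈ P, ∀ m, 0 ≤ p m := fun p hp m => (hPs hp).1 m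
  have hq0 : ∀ p ∈ Q, ∀ m, 0 ≤ p m := fun p hp m => (hQs hp).1 m
  have hpp : ∀ m, 0 < p₀ m + ε := fun m => by linarith [hp0 p₀ hp₀ m]
  have hqp : ∀ m, 0 < q₀ m + ε := fun m => by linarith [hq0 q₀ hq₀ m]
  have hval : ∑ m, √((p₀ m + ε) * (q₀ m + ε)) ≤ 1 - r / 4 := by
    have h1 : ∀ m, √((p₀ m + ε) * (q₀ m + ε)) ≤ √(p₀ m * q₀ m) + r / (4 * n) := fun m => by
      rw [← hsq]
      have a := hp0 p₀ hp₀ m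
      have b := hq0 q₀ hq₀ m
      refine le_trans (Real.sqrt_le_sqrt ?_) (sqrt_add_le_add_sqrt (mul_nonneg a b) (by positivity))
      have c := le_one_of_mem_stdSimplex (hPs hp₀) m
      have d := le_one_of_mem_stdSimplex (hQs hq₀) m
      nlinarith
    have h2 := Finset.sum_le_sum fun m (_ : m ∈ Finset.univ) => h1 m
    rw [Finset.sum_add_distrib, Finset.sum_const, Finset.card_univ, nsmul_eq_mul] at h2
    have h3 := hgap p₀ hp₀ q₀ hq₀
    rw [hellingerSq_eq (hPs hp₀) (hQs hq₀)] at h3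
    have h4 : (Fintype.card Z : ℝ) * (r / (4 * n)) ≤ r / 4 := by
      rw [mul_div_assoc', div_le_div_iff₀ (by positivity) (by norm_num), hn]
      nlinarith
    linarith
  refine ⟨fun m => √((q₀ m + ε) / (p₀ m + ε)), fun m => Real.sqrt_pos.2 (div_pos (hqp m) (hpp m)),
    fun p hp => ?_, fun q hq => ?_⟩
  · exact (sum_mul_sqrt_div_le hPc hp0 hε hqp hp₀ (fun p hp => hmax (Set.mk_mem_prod hp hq₀))
      hp).trans hval
  · have := sum_mul_sqrt_div_le hQc hq0 hε hpp hq₀ (fun q hq => by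
      have := hmax (Set.mk_mem_prod hp₀ hq)
      simpa only [mul_comm, Set.mem_ofPred_eq] using this) hq
    refine le_trans (le_of_eq ?_) (this.trans ?_)
    · refine Finset.sum_congr rfl fun m _ => ?_
      rw [← Real.sqrt_inv, inv_div]
    · simpa only [mul_comm] using hval

lemma hellingerSq_of_lt_gap {X Y Z : Type*} [Fintype Z] (𝒦 : NoisyKernel X Y Z) {x : X} {r : ℝ}
    (h : ENNReal.ofReal r < 𝒦.gap x) {y y' : Y} (hy : y ≠ y') {p q : Z → ℝ} (hp : p ∈ 𝒦.Q x y)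
    (hq : q ∈ 𝒦.Q x y') : r ≤ hellingerSq p q := by
  have h1 : 𝒦.gap x ≤ ENNReal.ofReal (hellingerSq p q) :=
    (iInf_le_of_le y <| iInf_le_of_le y' <| iInf_le_of_le hy <|
      iInf₂_le_of_le p hp <| iInf₂_le_of_le q hq le_rfl)
  exact (ENNReal.ofReal_lt_ofReal_iff'.1 (h.trans_le h1)).1.le

/-- Pairwise comparison weights for the labels at a feature: under label `y` the weight of `y'`
against `y` has mean at most one, while opposite weights have product at least `1 + r / 2` as soon
as the gap of the feature exceeds `r`. -/
lemma exists_weights {X Y Z : Type*} [Fintype Z] (𝒦 : NoisyKernel X Y Z) {r : ℝ} (hr : 0 < r)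
    (hr1 : r ≤ 1) :
    ∃ g : X → Y → Y → Z → ℝ, (∀ x y y' m, 0 < g x y y' m) ∧
      (∀ x y y', ∀ p ∈ 𝒦.Q x y, ∑ m, p m * g x y y' m ≤ 1) ∧
      (∀ x y y' m, 1 ≤ g x y y' m * g x y' y m) ∧
      ∀ x y y' m, ENNReal.ofReal r < 𝒦.gap x → y ≠ y' →
        1 + r / 2 ≤ g x y y' m * g x y' y m := by
  classical
  have key : ∀ x, ENNReal.ofReal r < 𝒦.gap x → ∀ y y', y ≠ y' → ∃ φ : Z → ℝ, (∀ m, 0 < φ m) ∧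
      (∀ p ∈ 𝒦.Q x y, ∑ m, p m * φ m ≤ 1 - r / 4) ∧
      ∀ q ∈ 𝒦.Q x y', ∑ m, q m * (φ m)⁻¹ ≤ 1 - r / 4 := fun x hx y y' hy =>
    exists_test (𝒦.subset_simplex x y) (𝒦.subset_simplex x y') (𝒦.nonempty x y) (𝒦.nonempty x y')
      (𝒦.convex x y) (𝒦.convex x y') (𝒦.closed x y) (𝒦.closed x y') hr hr1
      fun p hp q hq => hellingerSq_of_lt_gap 𝒦 hx hy hp hq
  choose! φ hφ0 hφ1 hφ2 using key
  have hr4 : 0 < 1 - r / 4 := by linarith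
  -- The tests for `(y, y')` and `(y', y)` are chosen independently. Averaging one with the inverse
  -- of the other keeps the mean bound and, by AM-GM, makes opposite averages multiply to at least
  -- one; the normalization then gains `(1 - r / 4)⁻² ≥ 1 + r / 2`.
  set g : X → Y → Y → Z → ℝ := fun x y y' m =>
    if ENNReal.ofReal r < 𝒦.gap x ∧ y ≠ y' then
      (φ x y y' m + (φ x y' y m)⁻¹) / 2 / (1 - r / 4) else 1 with hg
  have hprod : ∀ x y y' m, ENNReal.ofReal r < 𝒦.gap x → y ≠ y' →
        1 + r / 2 ≤ g x y y' m * g x y' y m := by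
    intro x y y' m hx hy
    simp only [hg, if_pos (And.intro hx hy), if_pos (And.intro hx hy.symm)]
    have a := hφ0 x hx y y' hy m
    have b := hφ0 x hx y' y hy.symm m
    generalize φ x y y' m = s at *
    generalize φ x y' y m = t at *
    have e : (s + t⁻¹) / 2 / (1 - r / 4) * ((t + s⁻¹) / 2 / (1 - r / 4)) =
        (1 + (s * t - 1) ^ 2 / (4 * (s * t))) / (1 - r / 4) ^ 2 := by
      field_simp
      ring
    rw [e, le_div_iff₀ (by positivity)]
    have : 0 ≤ (s * t - 1) ^ 2 / (4 * (s * t)) := by positivity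
    nlinarith [sq_nonneg r, mul_pos hr hr, mul_pos (mul_pos hr hr) hr]
  refine ⟨g, fun x y y' m => ?_, fun x y y' p hp => ?_, fun x y y' m => ?_, hprod⟩
  · simp only [hg]
    split_ifs with h
    · have a := hφ0 x h.1 y y' h.2 m
      have b := hφ0 x h.1 y' y h.2.symm m
      positivity
    · exact one_pos
  · simp only [hg]
    split_ifs with h
    · have a := hφ1 x h.1 y y' h.2 p hp
      have b := hφ2 x h.1 y' y h.2.symm p hp
      have e : ∑ m, p m * ((φ x y y' m + (φ x y' y m)⁻¹) / 2 / (1 - r / 4)) =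
          (∑ m, p m * φ x y y' m + ∑ m, p m * (φ x y' y m)⁻¹) / 2 / (1 - r / 4) := by
        rw [← Finset.sum_add_distrib, Finset.sum_div, Finset.sum_div]
        exact Finset.sum_congr rfl fun m _ => by ring
      rw [e, div_le_one hr4]
      linarith
    · simp [(𝒦.subset_simplex x y hp).2]
  · by_cases h : ENNReal.ofReal r < 𝒦.gap x ∧ y ≠ y'
    · linarith [hprod x y y' m h.1 h.2]
    · have h' : ¬ (ENNReal.ofReal r < 𝒦.gap x ∧ y' ≠ y) := fun h' => h ⟨h'.1, h'.2.symm⟩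
      simp [hg, if_neg h, if_neg h']

/-! ### Elimination of hypotheses by pairwise comparisons -/

/-- If each surviving item has left at most `L` times its mark before, and one item survives without
marks, then the fractions of marked survivors add up to at most `(L + 1) log |S 0|`. -/
lemma sum_marked_fraction_le {ι : Type*} [DecidableEq ι] {S D : ℕ → Finset ι} (hS : Antitone S)
    {T : ℕ} {i : ι} (hi : i ∈ S T) (hD : ∀ t, i ∉ D t) {L : ℝ} (hL0 : 0 ≤ L)
    (hL : ∀ t ≤ T, ∀ j ∈ S t, (((Finset.range t).filter fun s => j ∈ D s).card : ℝ) ≤ L) :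
    ∑ t ∈ Finset.range T, ((S t ∩ D t).card : ℝ) / (S t).card ≤ (L + 1) * Real.log (S 0).card := by
  set n : ι → ℕ → ℝ := fun j t => (((Finset.range t).filter fun s => j ∈ D s).card : ℝ) with hn
  have hn_succ : ∀ j t, n j (t + 1) = n j t + if j ∈ D t then 1 else 0 := fun j t => by
    simp only [hn, Finset.range_add_one, Finset.filter_insert]
    split_ifs <;> simp
  have hni : ∀ t, n i t = 0 := fun t => by simp [hn, hD]
  -- A potential: each survivor weighs one plus its remaining allowance of marks. A mark costs one
  -- unit, and the extra one keeps the weight nonnegative even if the item is marked and removed in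
  -- the same round. The decrease of `log W` pays for the marked fraction, and the unmarked `i`
  -- keeps `W` at least `L + 1`.
  set W : ℕ → ℝ := fun t => ∑ j ∈ S t, (L + 1 - n j t) with hW
  have hsub : ∀ t < T, W (t + 1) ≤ W t - (S t ∩ D t).card := by
    intro t ht
    have h1 : W (t + 1) ≤ ∑ j ∈ S t, (L + 1 - n j (t + 1)) := by
      refine Finset.sum_le_sum_of_subset_of_nonneg (hS t.le_succ) fun j hj _ => ?_
      have := hL t ht.le j hj
      rw [hn_succ]
      split_ifs <;> linarith
    refine h1.trans (le_of_eq ?_)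
    have : ((S t ∩ D t).card : ℝ) = ∑ j ∈ S t, if j ∈ D t then 1 else 0 := by
      rw [Finset.sum_boole, Finset.filter_mem_eq_inter]
    rw [this, hW, ← Finset.sum_sub_distrib]
    exact Finset.sum_congr rfl fun j _ => by rw [hn_succ]; ring
  have hpos : ∀ t ≤ T, L + 1 ≤ W t ∧ W t ≤ (L + 1) * (S t).card := by
    intro t ht
    constructor
    · calc L + 1 = L + 1 - n i t := by rw [hni, sub_zero]
        _ ≤ W t := Finset.single_le_sum (f := fun j => L + 1 - n j t)
          (fun j hj => by linarith [hL t ht j hj]) (hS ht hi)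
    · rw [mul_comm, ← nsmul_eq_mul]
      refine Finset.sum_le_card_nsmul _ _ _ fun j _ => ?_
      have : 0 ≤ n j t := Nat.cast_nonneg _
      linarith
  have hstep : ∀ t ∈ Finset.range T, ((S t ∩ D t).card : ℝ) / (S t).card ≤
      (L + 1) * (Real.log (W t) - Real.log (W (t + 1))) := by
    intro t ht
    have ht' : t < T := Finset.mem_range.1 ht
    obtain ⟨a, b⟩ := hpos t ht'.le
    have c := (hpos (t + 1) ht').1
    have hW0 : 0 < W t := by linarith
    have hW1 : 0 < W (t + 1) := by linarith
    have hS0 : (0 : ℝ) < (S t).card := by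
      exact_mod_cast Finset.card_pos.2 ⟨i, hS ht'.le hi⟩
    have h1 := Real.log_le_sub_one_of_pos (div_pos hW1 hW0)
    rw [Real.log_div hW1.ne' hW0.ne'] at h1
    have h2 : W (t + 1) / W t ≤ 1 - (S t ∩ D t).card / W t := by
      rw [one_sub_div hW0.ne']
      exact div_le_div_of_nonneg_right (hsub t ht') hW0.le
    calc ((S t ∩ D t).card : ℝ) / (S t).card
        ≤ (L + 1) * ((S t ∩ D t).card / W t) := by
          rw [mul_div_assoc', div_le_div_iff₀ hS0 hW0]
          have : (0 : ℝ) ≤ (S t ∩ D t).card := Nat.cast_nonneg _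
          nlinarith
      _ ≤ _ := mul_le_mul_of_nonneg_left (by linarith) (by linarith)
  refine (Finset.sum_le_sum hstep).trans ?_
  rw [← Finset.mul_sum, Finset.sum_range_sub']
  refine mul_le_mul_of_nonneg_left ?_ (by linarith)
  have hS0 : (0 : ℝ) < (S 0).card := by
    exact_mod_cast Finset.card_pos.2 ⟨i, hS T.zero_le hi⟩
  have h1 := Real.log_le_log (by linarith) (hpos T le_rfl).1
  have h2 := Real.log_le_log (by linarith [(hpos 0 T.zero_le).1]) (hpos 0 T.zero_le).2
  rw [Real.log_mul (by linarith) hS0.ne'] at h2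
  linarith

section Elimination

variable {X : Type u} {Y : Type v} {Z : Type w}

/-- The evidence of the hypothesis `k` against `j` in the first `s` rounds. -/
def evidence (g : X → Y → Y → Z → ℝ) (x : ℕ → X) (z : ℕ → Z) (j k : X → Y) (s : ℕ) : ℝ :=
  ∏ i ∈ Finset.range s, g (x i) (j (x i)) (k (x i)) (z i)

open Classical in
/-- The hypotheses against which there never was evidence above `B` in the first `t` rounds. -/
noncomputable def alive (g : X → Y → Y → Z → ℝ) (B : ℝ) (H : Finset (X → Y)) (x : ℕ → X)
    (z : ℕ → Z) (t : ℕ) : Finset (X → Y) :=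
  H.filter fun j => ∀ s ≤ t, ∀ k ∈ H, evidence g x z j k s ≤ B

lemma mem_alive {g : X → Y → Y → Z → ℝ} {B : ℝ} {H : Finset (X → Y)} {x : ℕ → X} {z : ℕ → Z}
    {t : ℕ} {j : X → Y} :
    j ∈ alive g B H x z t ↔ j ∈ H ∧ ∀ s ≤ t, ∀ k ∈ H, evidence g x z j k s ≤ B := by
  classical simp [alive]

lemma alive_antitone (g : X → Y → Y → Z → ℝ) (B : ℝ) (H : Finset (X → Y)) (x : ℕ → X)
    (z : ℕ → Z) : Antitone (alive g B H x z) := fun _ _ hst _ hj =>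
  mem_alive.2 ⟨(mem_alive.1 hj).1, fun s hs => (mem_alive.1 hj).2 s (hs.trans hst)⟩

/-- Survival at time `t` depends only on earlier rounds, so the learner can compute it from what it
has seen. -/
lemma alive_congr (g : X → Y → Y → Z → ℝ) (B : ℝ) (H : Finset (X → Y)) {x x' : ℕ → X}
    {z z' : ℕ → Z} {t : ℕ} (hx : ∀ i < t, x i = x' i) (hz : ∀ i < t, z i = z' i) :
    alive g B H x z t = alive g B H x' z' t := by
  have : ∀ s ≤ t, ∀ j k, evidence g x z j k s = evidence g x' z' j k s := fun s hs j k =>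
    Finset.prod_congr rfl fun i hi => by
      have hi' := (Finset.mem_range.1 hi).trans_le hs
      rw [hx i hi', hz i hi']
  ext j
  simp only [mem_alive]
  exact and_congr_right fun _ => forall₂_congr fun s hs => by simp only [this s hs]

lemma evidence_pos {g : X → Y → Y → Z → ℝ} (hg : ∀ x y y' m, 0 < g x y y' m) (x : ℕ → X)
    (z : ℕ → Z) (j k : X → Y) (s : ℕ) : 0 < evidence g x z j k s :=
  Finset.prod_pos fun _ _ => hg _ _ _ _

open Classical in
/-- Two surviving hypotheses differ in few rounds with strong evidence. -/
lemma card_disagree_le {g : X → Y → Y → Z → ℝ} (hg : ∀ x y y' m, 0 < g x y y' m)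
    (hg1 : ∀ x y y' m, 1 ≤ g x y y' m * g x y' y m) {G : X → Prop} {r : ℝ} (hr : 0 < r)
    (hr1 : r ≤ 1)
    (hgr : ∀ x y y' m, G x → y ≠ y' → 1 + r / 2 ≤ g x y y' m * g x y' y m)
    {B : ℝ} (hB : 1 ≤ B) {H : Finset (X → Y)} {x : ℕ → X} {z : ℕ → Z} {t : ℕ} {i j : X → Y}
    (hi : i ∈ alive g B H x z t) (hj : j ∈ alive g B H x z t) :
    (((Finset.range t).filter fun s => G (x s) ∧ j (x s) ≠ i (x s)).card : ℝ) ≤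
      8 * Real.log B / r := by
  set n := ((Finset.range t).filter fun s => G (x s) ∧ j (x s) ≠ i (x s)).card
  -- Both survivors bound the evidence of the other by `B`, while the product of the two evidences
  -- gains a factor at each strong disagreement and never loses one.
  have h1 : (1 + r / 2) ^ n ≤ evidence g x z i j t * evidence g x z j i t := by
    rw [evidence, evidence, ← Finset.prod_mul_distrib, ← Finset.prod_const, Finset.prod_filter]
    refine Finset.prod_le_prod (fun s _ => by split_ifs <;> positivity) fun s _ => ?_
    split_ifs with h
    · exact hgr _ _ _ _ h.1 (Ne.symm h.2)
    · exact hg1 _ _ _ _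
  have h2 : evidence g x z i j t * evidence g x z j i t ≤ B * B :=
    mul_le_mul ((mem_alive.1 hi).2 t le_rfl j (mem_alive.1 hj).1)
      ((mem_alive.1 hj).2 t le_rfl i (mem_alive.1 hi).1) (evidence_pos hg _ _ _ _ _).le
      (by linarith)
  have h3 := Real.log_le_log (by positivity) (h1.trans h2)
  rw [Real.log_pow, Real.log_mul (by linarith) (by linarith)] at h3
  have h4 : r / 4 ≤ Real.log (1 + r / 2) := by
    refine le_trans ?_ (Real.one_sub_inv_le_log_of_pos (by positivity))
    rw [← sub_nonneg]
    have : 1 - (1 + r / 2)⁻¹ - r / 4 = r * (2 - r) / (8 * (1 + r / 2)) := by field_simp; ring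
    rw [this]
    exact div_nonneg (mul_nonneg hr.le (by linarith)) (by positivity)
  rw [le_div_iff₀ hr]
  have : (n : ℝ) * (r / 4) ≤ n * Real.log (1 + r / 2) :=
    mul_le_mul_of_nonneg_left h4 (Nat.cast_nonneg _)
  linarith

open Classical in
/-- The label at `x` of a uniformly chosen member of `S`. -/
noncomputable def vote [Nonempty Y] (S : Finset (X → Y)) (x : X) (y : Y) : ℝ :=
  if S.Nonempty then ((S.filter fun j => j x = y).card : ℝ) / S.card
  else if y = Classical.arbitrary Y then 1 else 0

lemma vote_mem_stdSimplex [Fintype Y] [Nonempty Y] (S : Finset (X → Y)) (x : X) :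
    vote S x ∈ stdSimplex ℝ Y := by
  classical
  refine ⟨fun y => ?_, ?_⟩
  · unfold vote
    split_ifs <;> positivity
  · unfold vote
    split_ifs with h
    · have h1 : S.card = ∑ y, (S.filter fun j => j x = y).card :=
        Finset.card_eq_sum_card_fiberwise fun _ _ => Finset.mem_coe.2 (Finset.mem_univ _)
      rw [← Finset.sum_div, ← Nat.cast_sum, ← h1]
      exact div_self (by exact_mod_cast (Finset.card_pos.2 h).ne')
    · simp

open Classical in
lemma sum_error_eq [Fintype Y] {q : Y → ℝ} (hq : q ∈ stdSimplex ℝ Y) (y : Y) :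
    ∑ y', q y' * (if y ≠ y' then 1 else 0) = 1 - q y := by
  have : ∀ y', q y' * (if y ≠ y' then (1 : ℝ) else 0) = q y' - if y = y' then q y' else 0 :=
    fun y' => by by_cases h : y = y' <;> simp [h]
  simp only [this, Finset.sum_sub_distrib, hq.2]
  simp

open Classical in
lemma one_sub_vote [Nonempty Y] {S : Finset (X → Y)} {i : X → Y} (hi : i ∈ S) (x : X) :
    1 - vote S x (i x) = ((S.filter fun j => j x ≠ i x).card : ℝ) / S.card := by
  have h : S.Nonempty := ⟨i, hi⟩
  have h0 : (S.card : ℝ) ≠ 0 := by exact_mod_cast (Finset.card_pos.2 h).ne'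
  have h1 : ((S.filter fun j => j x = i x).card : ℝ) + (S.filter fun j => j x ≠ i x).card =
      S.card := by exact_mod_cast S.card_filter_add_card_filter_not _
  rw [vote, if_pos h, eq_div_iff h0, sub_mul, div_mul_cancel₀ _ h0]
  linarith

/-- A finite sequence continued by a constant. -/
def extendSeq {α : Type*} {n : ℕ} (d : α) (f : Fin n → α) (i : ℕ) : α :=
  if h : i < n then f ⟨i, h⟩ else d

/-- The learner that follows a uniformly chosen surviving hypothesis. -/
noncomputable def eliminationLearner [Fintype Y] [Nonempty Y] [Nonempty Z]
    (g : X → Y → Y → Z → ℝ) (B : ℝ) (H : Finset (X → Y)) : Learner X Y Z where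
  -- The default values are never read: survival at time `t` uses only indices below `t`.
  predict t xs zs := vote (alive g B H (extendSeq (xs 0) xs)
    (extendSeq (Classical.arbitrary Z) zs) t) (xs (Fin.last t))
  mem_simplex _ _ _ := vote_mem_stdSimplex _ _

end Elimination

/-! ### Upper bound -/

section UpperBound

variable {X : Type u} {Y : Type v} {Z : Type w}

lemma extendSeq_of_lt {α : Type*} {n : ℕ} (d : α) (f : Fin n → α) {i : ℕ} (h : i < n) :
    extendSeq d f i = f ⟨i, h⟩ := dif_pos h

lemma extendSeq_val {α : Type*} {n : ℕ} (d : α) (f : Fin n → α) (i : Fin n) :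
    extendSeq d f i = f i := dif_pos i.isLt

/-- The expected evidence against the truth never exceeds one. -/
lemma sum_labelProb_mul_evidence_le_one [Fintype Z] {𝒦 : NoisyKernel X Y Z} {g : X → Y → Y → Z → ℝ}
    (hg : ∀ x y y' m, 0 < g x y y' m) (hg1 : ∀ x y y', ∀ p ∈ 𝒦.Q x y, ∑ m, p m * g x y y' m ≤ 1)
    {T : ℕ} {h : X → Y} {ψ : FeatureSelector X Z} {p : NoiseSelector Z}
    (hp : IsAdmissibleNoise 𝒦 T h ψ p) (d : X) (z₀ : Z) (k : X → Y) {s : ℕ} (hs : s ≤ T) :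
    ∑ z : Fin T → Z, labelProb p z *
      evidence g (extendSeq d (featureAt ψ z)) (extendSeq z₀ z) h k s ≤ 1 := by
  -- The conditional laws of `p` tilted by the first `s` weights; each has mass at most one because
  -- `h` is the truth.
  set q : NoiseSelector Z := fun t zs m =>
    p t zs m * if t < s then g (ψ t zs) (h (ψ t zs)) (k (ψ t zs)) m else 1 with hq
  have hpq : ∀ z : Fin T → Z, labelProb p z *
      evidence g (extendSeq d (featureAt ψ z)) (extendSeq z₀ z) h k s = labelProb q z := by
    intro z
    have hr : Finset.range s = (Finset.range T).filter fun i => i < s := by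
      ext i; simp only [Finset.mem_range, Finset.mem_filter]; omega
    rw [evidence, hr, Finset.prod_filter, Finset.prod_range, labelProb, labelProb,
      ← Finset.prod_mul_distrib]
    refine Finset.prod_congr rfl fun t _ => ?_
    simp only [extendSeq_val, hq, featureAt]
  simp only [hpq]
  refine sum_labelProb_le_one (fun t ht zs m => ?_) fun t ht zs => ?_
  · refine mul_nonneg ((𝒦.subset_simplex _ _ (hp t ht zs)).1 m) ?_
    split_ifs
    exacts [(hg _ _ _ _).le, zero_le_one]
  · simp only [hq]
    split_ifs
    · exact hg1 _ _ _ _ (hp t ht zs)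
    · simpa using (𝒦.subset_simplex _ _ (hp t ht zs)).2.le

open Classical in
/-- Errors of the elimination learner on a sequence of labels along which the truth survives. -/
lemma sum_error_le_of_mem_alive [Fintype Y] [Nonempty Y] [Nonempty Z] {g : X → Y → Y → Z → ℝ}
    (hg : ∀ x y y' m, 0 < g x y y' m)
    (hg1 : ∀ x y y' m, 1 ≤ g x y y' m * g x y' y m) {G : X → Prop} {r : ℝ}
    (hr : 0 < r) (hr1 : r ≤ 1)
    (hgr : ∀ x y y' m, G x → y ≠ y' → 1 + r / 2 ≤ g x y y' m * g x y' y m)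
    {B : ℝ} (hB : 1 ≤ B) {H : Finset (X → Y)} {x : ℕ → X} {z : ℕ → Z} {T : ℕ} {i : X → Y}
    (hi : i ∈ alive g B H x z T) :
    ∑ t ∈ Finset.range T, (1 - vote (alive g B H x z t) (x t) (i (x t))) ≤
      (∑ t ∈ Finset.range T, if G (x t) then 0 else 1) +
        (8 * Real.log B / r + 1) * Real.log H.card := by
  set S := alive g B H x z with hS
  have hanti : Antitone S := alive_antitone g B H x z
  -- Restricting to `H` only keeps the marked set finite; survivors lie in `H` anyway.
  set D : ℕ → Finset (X → Y) := fun t => H.filter fun j => G (x t) ∧ j (x t) ≠ i (x t) with hD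
  have hmem : ∀ t, ∀ j ∈ S t, ∀ s, j ∈ D s ↔ G (x s) ∧ j (x s) ≠ i (x s) := fun t j hj s => by
    simp [hD, (mem_alive.1 hj).1]
  have hB0 := Real.log_nonneg hB
  have hmain := sum_marked_fraction_le hanti (D := D) (L := 8 * Real.log B / r) hi
    (fun t => by simp [hD]) (by positivity) fun t ht j hj => by
      simp only [hmem t j hj]
      exact card_disagree_le hg hg1 hr hr1 hgr hB (hanti ht hi) hj
  have hlog : Real.log (S 0).card ≤ Real.log H.card := by
    refine Real.log_le_log ?_ ?_
    · exact_mod_cast Finset.card_pos.2 ⟨i, hanti T.zero_le hi⟩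
    · exact_mod_cast Finset.card_le_card fun j hj => (mem_alive.1 hj).1
  have hstep : ∀ t ∈ Finset.range T, 1 - vote (S t) (x t) (i (x t)) ≤
      (if G (x t) then 0 else 1) + ((S t ∩ D t).card : ℝ) / (S t).card := by
    intro t ht
    have hit : i ∈ S t := hanti (Finset.mem_range.1 ht).le hi
    by_cases hG : G (x t)
    · rw [one_sub_vote hit, if_pos hG, zero_add]
      have : (S t).filter (fun j => j (x t) ≠ i (x t)) = S t ∩ D t := by
        ext j
        simp only [Finset.mem_filter, Finset.mem_inter]
        exact and_congr_right fun hj => by simp [hmem t j hj, hG]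
      rw [this]
    · rw [if_neg hG]
      have h1 := (vote_mem_stdSimplex (S t) (x t)).1 (i (x t))
      have h2 : (0 : ℝ) ≤ ((S t ∩ D t).card : ℝ) / (S t).card := by positivity
      linarith
  refine (Finset.sum_le_sum hstep).trans ?_
  rw [Finset.sum_add_distrib]
  have : (8 * Real.log B / r + 1) * Real.log (S 0).card ≤
      (8 * Real.log B / r + 1) * Real.log H.card :=
    mul_le_mul_of_nonneg_left hlog (by positivity)
  linarith

open Classical in
/-- Expected errors of the elimination learner. -/
lemma expectedErrors_eliminationLearner_le [Fintype Y] [Fintype Z] [Nonempty Y] [Nonempty Z] {𝒦 : NoisyKernel X Y Z}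
    {g : X → Y → Y → Z → ℝ} (hg : ∀ x y y' m, 0 < g x y y' m)
    (hgp : ∀ x y y', ∀ p ∈ 𝒦.Q x y, ∑ m, p m * g x y y' m ≤ 1)
    (hg1 : ∀ x y y' m, 1 ≤ g x y y' m * g x y' y m) {G : X → Prop} {r : ℝ}
    (hr : 0 < r) (hr1 : r ≤ 1)
    (hgr : ∀ x y y' m, G x → y ≠ y' → 1 + r / 2 ≤ g x y y' m * g x y' y m)
    {B : ℝ} (hB : 1 ≤ B) {H : Finset (X → Y)} {T : ℕ} {h : X → Y} (hH : h ∈ H)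
    {ψ : FeatureSelector X Z} {p : NoiseSelector Z}
    (hp : IsAdmissibleNoise 𝒦 T h ψ p) {b : ℝ} (hb : 0 ≤ b)
    (hbad : ∀ z : Fin T → Z, ∑ t : Fin T, (if G (featureAt ψ z t) then (0 : ℝ) else 1) ≤ b) :
    expectedErrors T (eliminationLearner g B H) h ψ p ≤
      b + (8 * Real.log B / r + 1) * Real.log H.card + T * ((T + 1) * H.card / B) := by
  obtain ⟨z₀⟩ := ‹Nonempty Z›
  set d : X := ψ 0 Fin.elim0 with hd
  set M : (Fin T → Z) → (X → Y) → ℕ → ℝ := fun z k s =>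
    evidence g (extendSeq d (featureAt ψ z)) (extendSeq z₀ z) h k s with hM
  have hB0 : 0 < B := by linarith
  have hlogB := Real.log_nonneg hB
  have hlogH : 0 ≤ Real.log H.card := Real.log_natCast_nonneg _
  have hP0 : ∀ z : Fin T → Z, 0 ≤ labelProb p z := labelProb_nonneg fun t ht zs m =>
    (𝒦.subset_simplex _ _ (hp t ht zs)).1 m
  have hP1 : ∑ z : Fin T → Z, labelProb p z = 1 := sum_labelProb_eq_one fun t ht zs =>
    (𝒦.subset_simplex _ _ (hp t ht zs)).2
  have hM0 : ∀ z k s, 0 < M z k s := fun z k s => evidence_pos hg _ _ _ _ _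
  have hsum0 : ∀ z, 0 ≤ ∑ s ∈ Finset.range (T + 1), ∑ k ∈ H, M z k s / B := fun z =>
    Finset.sum_nonneg fun s _ => Finset.sum_nonneg fun k _ => (div_pos (hM0 z k s) hB0).le
  have hz : ∀ z : Fin T → Z, ∑ t : Fin T, ∑ y : Y, (eliminationLearner g B H).predict t
      (featuresUpTo ψ z t) (pastLabels z t t.isLt.le) y *
        (if h (featureAt ψ z t) ≠ y then 1 else 0) ≤
      b + (8 * Real.log B / r + 1) * Real.log H.card +
        T * ∑ s ∈ Finset.range (T + 1), ∑ k ∈ H, M z k s / B := by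
    intro z
    have e1 : ∀ t : Fin T, ∑ y : Y, (eliminationLearner g B H).predict t
      (featuresUpTo ψ z t) (pastLabels z t t.isLt.le) y *
        (if h (featureAt ψ z t) ≠ y then 1 else 0) =
        1 - vote (alive g B H (extendSeq d (featureAt ψ z)) (extendSeq z₀ z) t)
          (extendSeq d (featureAt ψ z) t) (h (extendSeq d (featureAt ψ z) t)) := by
      intro t
      rw [sum_error_eq ((eliminationLearner g B H).mem_simplex _ _ _), extendSeq_val]
      simp only [eliminationLearner]
      rw [alive_congr g B H (x' := extendSeq d (featureAt ψ z)) (z' := extendSeq z₀ z)]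
      · rfl
      · intro i hi
        rw [extendSeq_of_lt _ _ (hi.trans t.val.lt_succ_self), extendSeq_of_lt _ _ (hi.trans t.isLt)]
        rfl
      · intro i hi
        rw [extendSeq_of_lt _ _ hi, extendSeq_of_lt _ _ (hi.trans t.isLt)]
        rfl
    simp only [e1]
    by_cases hal : h ∈ alive g B H (extendSeq d (featureAt ψ z)) (extendSeq z₀ z) T
    · have := sum_error_le_of_mem_alive hg hg1 hr hr1 hgr hB hal
      rw [Finset.sum_range, Finset.sum_range] at this
      have h2 := hbad z
      simp only [extendSeq_val] at this h2 ⊢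
      have h3 := mul_nonneg (Nat.cast_nonneg (α := ℝ) T) (hsum0 z)
      linarith
    -- If the truth is eliminated, some evidence against it exceeds `B`, so this sum dominates the
    -- indicator of elimination. Its expectation supplies Markov and the union bound at once.
    · have h1 : (1 : ℝ) ≤ ∑ s ∈ Finset.range (T + 1), ∑ k ∈ H, M z k s / B := by
        have : ∃ s ≤ T, ∃ k ∈ H, B < M z k s := by
          by_contra! hc
          exact hal (mem_alive.2 ⟨hH, hc⟩)
        obtain ⟨s, hs, k, hk, hlt⟩ := this
        refine le_trans ?_ (Finset.single_le_sum (f := fun s => ∑ k ∈ H, M z k s / B)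
          (fun s _ => Finset.sum_nonneg fun k _ => (div_pos (hM0 z k s) hB0).le)
          (Finset.mem_range.2 (Nat.lt_succ_of_le hs)))
        refine le_trans ?_ (Finset.single_le_sum (f := fun k => M z k s / B)
          (fun k _ => (div_pos (hM0 z k s) hB0).le) hk)
        exact (one_le_div hB0).2 hlt.le
      have h2 : ∀ t : Fin T, 1 - vote (alive g B H (extendSeq d (featureAt ψ z))
          (extendSeq z₀ z) t) (extendSeq d (featureAt ψ z) t)
          (h (extendSeq d (featureAt ψ z) t)) ≤ 1 := fun t =>
        sub_le_self _ ((vote_mem_stdSimplex _ _).1 _)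
      have h3 := Finset.sum_le_sum fun t (_ : t ∈ Finset.univ) => h2 t
      rw [Finset.sum_const, Finset.card_univ, Fintype.card_fin, nsmul_eq_mul, mul_one] at h3
      have h4 : (T : ℝ) * 1 ≤ T * ∑ s ∈ Finset.range (T + 1), ∑ k ∈ H, M z k s / B :=
        mul_le_mul_of_nonneg_left h1 (Nat.cast_nonneg _)
      have h5 : 0 ≤ (8 * Real.log B / r + 1) * Real.log H.card := by positivity
      linarith
  have hE : ∑ z : Fin T → Z, labelProb p z * ∑ s ∈ Finset.range (T + 1), ∑ k ∈ H, M z k s / B ≤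
      (T + 1) * H.card / B := by
    have e : ∀ z, labelProb p z * ∑ s ∈ Finset.range (T + 1), ∑ k ∈ H, M z k s / B =
        ∑ s ∈ Finset.range (T + 1), ∑ k ∈ H, labelProb p z * M z k s / B := fun z => by
      simp only [Finset.mul_sum, mul_div_assoc]
    simp only [e]
    rw [Finset.sum_comm]
    have : ∀ s ∈ Finset.range (T + 1),
        ∑ z : Fin T → Z, ∑ k ∈ H, labelProb p z * M z k s / B ≤ H.card / B := by
      intro s hs
      rw [Finset.sum_comm]
      calc ∑ k ∈ H, ∑ z : Fin T → Z, labelProb p z * M z k s / B ≤ ∑ k ∈ H, 1 / B := by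
            refine Finset.sum_le_sum fun k _ => ?_
            rw [← Finset.sum_div]
            exact div_le_div_of_nonneg_right (sum_labelProb_mul_evidence_le_one hg hgp hp d z₀ k
              (Nat.lt_succ_iff.1 (Finset.mem_range.1 hs))) hB0.le
        _ = H.card / B := by rw [Finset.sum_const, nsmul_eq_mul, mul_one_div]
    refine (Finset.sum_le_sum this).trans (le_of_eq ?_)
    rw [Finset.sum_const, Finset.card_range, nsmul_eq_mul]
    push_cast
    ring
  calc expectedErrors T (eliminationLearner g B H) h ψ p
      ≤ ∑ z : Fin T → Z, labelProb p z * (b + (8 * Real.log B / r + 1) * Real.log H.card +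
        T * ∑ s ∈ Finset.range (T + 1), ∑ k ∈ H, M z k s / B) :=
        Finset.sum_le_sum fun z _ => mul_le_mul_of_nonneg_left (hz z) (hP0 z)
    _ = (b + (8 * Real.log B / r + 1) * Real.log H.card) * ∑ z : Fin T → Z, labelProb p z +
        T * ∑ z : Fin T → Z, labelProb p z *
          ∑ s ∈ Finset.range (T + 1), ∑ k ∈ H, M z k s / B := by
        rw [Finset.mul_sum, Finset.mul_sum, ← Finset.sum_add_distrib]
        exact Finset.sum_congr rfl fun z _ => by ring
    _ ≤ _ := by
        rw [hP1, mul_one]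
        have := mul_le_mul_of_nonneg_left hE (Nat.cast_nonneg (α := ℝ) T)
        linarith

/-- The soft constraint counts least gaps over all histories, which lie below the gap along the
realized one. -/
lemma SoftGap.sum_small_gap_le [Fintype Z] {A α : ℝ} {T : ℕ} (hT : 1 ≤ T) {𝒦 : NoisyKernel X Y Z}
    {ψ : FeatureSelector X Z} (hψ : SoftGap A α T 𝒦 ψ) {r : ℝ} (hr : 0 < r) (hr1 : r ≤ 1 / 2)
    [DecidablePred fun x => ENNReal.ofReal r < 𝒦.gap x] (z : Fin T → Z) :
    ∑ t : Fin T, (if ENNReal.ofReal r < 𝒦.gap (featureAt ψ z t) then (0 : ℝ) else 1) ≤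
      T * (A * r ^ (α / (1 - α))) := by
  have hT0 : (0 : ℝ) < T := by exact_mod_cast hT
  have h := hψ r hr hr1
  rw [one_div, inv_mul_le_iff₀ hT0, Finset.sum_range] at h
  refine le_trans (Finset.sum_le_sum fun t _ => ?_) h
  split_ifs with h1 h2 h2
  · exact zero_le_one
  · exact le_rfl
  · exact le_rfl
  · exact absurd ((iInf_le (fun zs => 𝒦.gap (ψ t zs)) (pastLabels z t t.isLt.le)).trans (not_lt.1 h1)) h2

theorem softWorstRisk_le [Fintype Y] [Fintype Z] [Nontrivial Y] [Nontrivial Z] {A α : ℝ} (hA : 0 < A) (hα₀ : 0 ≤ α)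
    (hα₁ : α < 1) {T K : ℕ} (hT : 1 ≤ T) (hK : 2 ≤ K) :
    softWorstRisk X Y Z A α T K ≤ ENNReal.ofReal
      ((A + 34) * ((1 + Real.log T) * (1 + Real.log K)) ^ 2 * (T : ℝ) ^ (1 - α)) := by
  classical
  have hT1 : (1 : ℝ) ≤ T := by exact_mod_cast hT
  have hK2 : (2 : ℝ) ≤ K := by exact_mod_cast hK
  have hT0 : (0 : ℝ) < T := by linarith
  set U : ℝ := (T : ℝ) ^ (1 - α) with hU
  have hU1 : 1 ≤ U := Real.one_le_rpow hT1 (by linarith)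
  have hU0 : 0 < U := by linarith
  -- This threshold balances the number of small-gap rounds against `1 / r`; the factor two keeps `r
  -- ≤ 1 / 2` even for `T = 1`.
  set r : ℝ := 1 / (2 * U) with hrdef
  have hr : 0 < r := by positivity
  have hr1 : r ≤ 1 / 2 := by
    rw [hrdef]
    exact one_div_le_one_div_of_le (by norm_num) (by linarith)
  -- Large enough that losing the truth costs at most one error in expectation: `T * (T + 1) * K ≤
  -- B`.
  set B : ℝ := 2 * K * T ^ 2 with hBdef
  have hB : 1 ≤ B := by
    have : (1 : ℝ) ≤ (T : ℝ) ^ 2 := one_le_pow₀ hT1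
    rw [hBdef]; nlinarith
  have hlogT : 0 ≤ Real.log T := Real.log_nonneg hT1
  have hlogK : 0 ≤ Real.log K := Real.log_nonneg (by linarith)
  set P : ℝ := (1 + Real.log T) * (1 + Real.log K) with hP
  have hP1 : 1 ≤ P := by rw [hP]; nlinarith [mul_nonneg hlogT hlogK]
  have hlogB : Real.log B ≤ 2 * P := by
    rw [hBdef, Real.log_mul (by positivity) (by positivity), Real.log_mul (by norm_num)
      (by positivity), Real.log_pow]
    have := Real.log_two_lt_d9
    push_cast
    rw [hP]
    nlinarith [mul_nonneg hlogT hlogK]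
  have hpow : r ^ (α / (1 - α)) * T ≤ U := by
    have hβ : 0 ≤ α / (1 - α) := div_nonneg hα₀ (by linarith)
    have h1 : r ≤ (T : ℝ) ^ (-(1 - α)) := by
      rw [Real.rpow_neg hT0.le, hrdef, one_div]
      exact inv_anti₀ hU0 (by linarith)
    have h2 : r ^ (α / (1 - α)) ≤ (T : ℝ) ^ (-α) := by
      refine (Real.rpow_le_rpow hr.le h1 hβ).trans (le_of_eq ?_)
      rw [← Real.rpow_mul hT0.le]
      congr 1
      have : 1 - α ≠ 0 := by linarith
      field_simp
    calc r ^ (α / (1 - α)) * T ≤ (T : ℝ) ^ (-α) * T := mul_le_mul_of_nonneg_right h2 hT0.le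
      _ = U := by
        rw [hU, ← Real.rpow_add_one hT0.ne']
        congr 1
        ring
  refine iSup₂_le fun 𝒦 _ => iSup₂_le fun H hH => ?_
  obtain ⟨g, hg, hgp, hg1, hgr⟩ := exists_weights 𝒦 hr (by linarith)
  refine iInf_le_of_le (eliminationLearner g B H) <| iSup₂_le fun h hh => iSup₂_le fun ψ hψ =>
    iSup₂_le fun p hp => ENNReal.ofReal_le_ofReal ?_
  have hψ' : SoftGap A α T 𝒦 ψ := hψ
  refine (expectedErrors_eliminationLearner_le hg hgp hg1 (G := fun x => ENNReal.ofReal r < 𝒦.gap x)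
    hr (by linarith) hgr hB (Finset.mem_coe.1 hh) hp (b := T * (A * r ^ (α / (1 - α)))) (by positivity)
    fun z => by convert hψ'.sum_small_gap_le hT hr hr1 z).trans ?_
  have hHK : (H.card : ℝ) ≤ K := by exact_mod_cast hH
  have hH1 : (1 : ℝ) ≤ H.card := by
    exact_mod_cast Finset.card_pos.2 ⟨h, Finset.mem_coe.1 hh⟩
  have hlogH : Real.log H.card ≤ P := by
    have := Real.log_le_log (by linarith) hHK
    rw [hP]
    nlinarith [mul_nonneg hlogT hlogK]
  have h1 : (T : ℝ) * (A * r ^ (α / (1 - α))) ≤ A * U := by nlinarith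
  have h2 : 8 * Real.log B / r + 1 ≤ 33 * P * U := by
    have : 8 * Real.log B / r = 16 * U * Real.log B := by rw [hrdef]; field_simp; ring
    rw [this]
    nlinarith [mul_le_mul_of_nonneg_left hlogB hU0.le, one_le_mul_of_one_le_of_one_le hP1 hU1]
  have h3 : (8 * Real.log B / r + 1) * Real.log H.card ≤ 33 * P * U * P :=
    mul_le_mul h2 hlogH (Real.log_nonneg hH1) (by positivity)
  have h4 : (T : ℝ) * ((T + 1) * H.card / B) ≤ 1 := by
    rw [mul_div_assoc', div_le_one (by linarith), hBdef]
    have a1 : (T : ℝ) * ((T + 1) * H.card) ≤ T * ((T + T) * K) := by gcongr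
    linarith [a1, (by ring : (T : ℝ) * ((T + T) * K) = 2 * K * T ^ 2)]
  have hP2 : 1 ≤ P ^ 2 := one_le_pow₀ hP1
  have h5 : A * U ≤ A * U * P ^ 2 := le_mul_of_one_le_right (by positivity) hP2
  have h6 : 1 ≤ P ^ 2 * U := one_le_mul_of_one_le_of_one_le hP2 hU1
  nlinarith

end UpperBound

/-! ### Lower bound -/

section LowerBound

variable {X : Type u} {Y : Type v} {Z : Type w}

lemma expectedErrors_eq [Fintype Y] [Fintype Z] (T : ℕ) (Φ : Learner X Y Z) (h : X → Y)
    (ψ : FeatureSelector X Z) (p : NoiseSelector Z) :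
    expectedErrors T Φ h ψ p = ∑ z : Fin T → Z, labelProb p z * ∑ t : Fin T,
      (1 - Φ.predict t (featuresUpTo ψ z t) (pastLabels z t t.isLt.le) (h (featureAt ψ z t))) := by
  simp only [expectedErrors, sum_error_eq (Φ.mem_simplex _ _ _)]

lemma IsAdmissibleNoise.labelProb_nonneg [Fintype Z] {𝒦 : NoisyKernel X Y Z} {T : ℕ} {h : X → Y}
    {ψ : FeatureSelector X Z} {p : NoiseSelector Z} (hp : IsAdmissibleNoise 𝒦 T h ψ p)
    (z : Fin T → Z) : 0 ≤ labelProb p z :=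
  _root_.labelProb_nonneg (fun t ht zs m => (𝒦.subset_simplex _ _ (hp t ht zs)).1 m) z

lemma IsAdmissibleNoise.sum_labelProb [Fintype Z] {𝒦 : NoisyKernel X Y Z} {T : ℕ} {h : X → Y}
    {ψ : FeatureSelector X Z} {p : NoiseSelector Z} (hp : IsAdmissibleNoise 𝒦 T h ψ p) :
    ∑ z : Fin T → Z, labelProb p z = 1 :=
  sum_labelProb_eq_one fun t ht zs => (𝒦.subset_simplex _ _ (hp t ht zs)).2

lemma Learner.one_le_errors_of_ne [Fintype Y] (Φ : Learner X Y Z) {y y' : Y} (h : y ≠ y')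
    (t : ℕ) (xs : Fin (t + 1) → X) (zs : Fin t → Z) :
    1 ≤ (1 - Φ.predict t xs zs y) + (1 - Φ.predict t xs zs y') := by
  classical
  have hs := Φ.mem_simplex t xs zs
  have := Finset.sum_le_sum_of_subset_of_nonneg (f := Φ.predict t xs zs)
    (Finset.subset_univ {y, y'}) fun i _ _ => hs.1 i
  rw [Finset.sum_pair h, hs.2] at this
  linarith

/-- The learner does not know which of the two hypotheses is true, and the larger of two errors is
at least their average. -/
lemma le_softWorstRisk_of_two_hypotheses [Fintype Y] [Fintype Z] {A α : ℝ} {T K : ℕ} (hK : 2 ≤ K)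
    {𝒦 : NoisyKernel X Y Z} {ψ : FeatureSelector X Z} (hψ : SoftGap A α T 𝒦 ψ) {h₁ h₂ : X → Y}
    {p₁ p₂ : NoiseSelector Z} (hp₁ : IsAdmissibleNoise 𝒦 T h₁ ψ p₁)
    (hp₂ : IsAdmissibleNoise 𝒦 T h₂ ψ p₂) {c : ℝ}
    (hc : ∀ Φ : Learner X Y Z, 2 * c ≤ expectedErrors T Φ h₁ ψ p₁ + expectedErrors T Φ h₂ ψ p₂) :
    ENNReal.ofReal c ≤ softWorstRisk X Y Z A α T K := by
  classical
  refine le_iSup₂_of_le 𝒦 ⟨ψ, hψ⟩ <| le_iSup₂_of_le {h₁, h₂} (Finset.card_le_two.trans hK) <|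
    le_iInf fun Φ => ?_
  have key : ∀ h ∈ ({h₁, h₂} : Finset (X → Y)), ∀ p, IsAdmissibleNoise 𝒦 T h ψ p →
      c ≤ expectedErrors T Φ h ψ p → ENNReal.ofReal c ≤ ⨆ h ∈ (({h₁, h₂} : Finset (X → Y)) :
        Set (X → Y)), ⨆ ψ ∈ {ψ | SoftGap A α T 𝒦 ψ}, ⨆ (p : NoiseSelector Z)
        (_ : IsAdmissibleNoise 𝒦 T h ψ p), ENNReal.ofReal (expectedErrors T Φ h ψ p) :=
    fun h hh p hp hcp => le_iSup₂_of_le h (Finset.mem_coe.2 hh) <|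
      le_iSup₂_of_le ψ hψ <| le_iSup₂_of_le p hp <| ENNReal.ofReal_le_ofReal hcp
  rcases le_total c (expectedErrors T Φ h₁ ψ p₁) with h | h
  · exact key h₁ (by simp) p₁ hp₁ h
  · exact key h₂ (by simp) p₂ hp₂ (by linarith [hc Φ])

/-- The first prediction alone costs one half. -/
lemma half_le_softWorstRisk [Fintype Y] [Fintype Z] [Nontrivial Y] {A α : ℝ} {T K : ℕ}
    (hT : 1 ≤ T) (hK : 2 ≤ K) (hne : (softKernels X Y Z A α T).Nonempty) :
    ENNReal.ofReal (1 / 2) ≤ softWorstRisk X Y Z A α T K := by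
  obtain ⟨𝒦, ψ, hψ⟩ := hne
  obtain ⟨y₁, y₂, hy⟩ := exists_pair_ne Y
  choose q hq using 𝒦.nonempty
  have hadm : ∀ y, IsAdmissibleNoise 𝒦 T (fun _ => y) ψ fun t zs => q (ψ t zs) y :=
    fun y t _ zs => hq _ _
  refine le_softWorstRisk_of_two_hypotheses hK hψ (hadm y₁) (hadm y₂) fun Φ => ?_
  set e : Y → ℝ := fun y => 1 - Φ.predict 0 (fun _ => ψ 0 Fin.elim0) Fin.elim0 y with he
  have hE : ∀ y, e y ≤ expectedErrors T Φ (fun _ => y) ψ fun t zs => q (ψ t zs) y := by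
    intro y
    rw [expectedErrors_eq]
    calc e y = ∑ z : Fin T → Z, labelProb (fun t zs => q (ψ t zs) y) z * e y := by
          rw [← Finset.sum_mul, (hadm y).sum_labelProb, one_mul]
      _ ≤ _ := by
          refine Finset.sum_le_sum fun z _ =>
            mul_le_mul_of_nonneg_left ?_ ((hadm y).labelProb_nonneg z)
          refine le_trans (le_of_eq ?_) (Finset.single_le_sum (fun t _ => ?_)
            (Finset.mem_univ (⟨0, hT⟩ : Fin T)))
          · have h1 : pastLabels z 0 (Nat.zero_le T) = Fin.elim0 := Subsingleton.elim _ _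
            have h2 : featuresUpTo ψ z ⟨0, hT⟩ = fun _ => ψ 0 Fin.elim0 := by
              funext i
              obtain rfl : i = 0 := Subsingleton.elim (α := Fin 1) _ _
              exact congrArg (ψ 0) h1
            simp only [he]
            rw [h2, h1]
          · exact sub_nonneg.2 (le_one_of_mem_stdSimplex (Φ.mem_simplex _ _ _) _)
  have h3 := Φ.one_le_errors_of_ne hy 0 (fun _ => ψ 0 Fin.elim0) Fin.elim0
  have := hE y₁
  have := hE y₂
  simp only [he] at *
  linarith

/-- Le Cam's argument: on a given label sequence the learner sees the same features under both
hypotheses, so in each of the first `N` rounds its two error probabilities add up to at least one.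
-/
lemma sum_min_le_expectedErrors_add [Fintype Y] [Fintype Z] {𝒦 : NoisyKernel X Y Z} {T N : ℕ}
    (hN : N ≤ T) {ψ : FeatureSelector X Z} {h₁ h₂ : X → Y}
    (hne : ∀ t < N, ∀ zs, h₁ (ψ t zs) ≠ h₂ (ψ t zs)) {p₁ p₂ : NoiseSelector Z}
    (hp₁ : IsAdmissibleNoise 𝒦 T h₁ ψ p₁) (hp₂ : IsAdmissibleNoise 𝒦 T h₂ ψ p₂)
    (Φ : Learner X Y Z) :
    N * ∑ z : Fin T → Z, min (labelProb p₁ z) (labelProb p₂ z) ≤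
      expectedErrors T Φ h₁ ψ p₁ + expectedErrors T Φ h₂ ψ p₂ := by
  rw [expectedErrors_eq, expectedErrors_eq, ← Finset.sum_add_distrib, Finset.mul_sum]
  refine Finset.sum_le_sum fun z _ => ?_
  set E : (X → Y) → Fin T → ℝ := fun h t =>
    1 - Φ.predict t (featuresUpTo ψ z t) (pastLabels z t t.isLt.le) (h (featureAt ψ z t)) with hE
  have hE0 : ∀ h t, 0 ≤ E h t := fun h t =>
    sub_nonneg.2 (le_one_of_mem_stdSimplex (Φ.mem_simplex _ _ _) _)
  have hmin : 0 ≤ min (labelProb p₁ z) (labelProb p₂ z) :=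
    le_min (hp₁.labelProb_nonneg z) (hp₂.labelProb_nonneg z)
  have hsum : (N : ℝ) ≤ ∑ t, E h₁ t + ∑ t, E h₂ t := by
    rw [← Finset.sum_add_distrib]
    calc (N : ℝ) = ∑ t ∈ Finset.range T, if t < N then (1 : ℝ) else 0 := by
          rw [Finset.sum_boole]
          congr 1
          have : (Finset.range T).filter (fun t => t < N) = Finset.range N := by
            ext i; simp only [Finset.mem_range, Finset.mem_filter]; omega
          rw [this, Finset.card_range]
      _ = ∑ t : Fin T, if (t : ℕ) < N then (1 : ℝ) else 0 := Finset.sum_range _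
      _ ≤ _ := by
          refine Finset.sum_le_sum fun t _ => ?_
          split_ifs with ht
          · exact Φ.one_le_errors_of_ne (hne t ht _) _ _ _
          · exact add_nonneg (hE0 _ _) (hE0 _ _)
  calc (N : ℝ) * min (labelProb p₁ z) (labelProb p₂ z)
      ≤ (∑ t, E h₁ t + ∑ t, E h₂ t) * min (labelProb p₁ z) (labelProb p₂ z) :=
        mul_le_mul_of_nonneg_right hsum hmin
    _ = min (labelProb p₁ z) (labelProb p₂ z) * ∑ t, E h₁ t +
        min (labelProb p₁ z) (labelProb p₂ z) * ∑ t, E h₂ t := by ring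
    _ ≤ _ := add_le_add
        (mul_le_mul_of_nonneg_right (min_le_left _ _) (Finset.sum_nonneg fun t _ => hE0 _ t))
        (mul_le_mul_of_nonneg_right (min_le_right _ _) (Finset.sum_nonneg fun t _ => hE0 _ t))

/-- For `a ≤ b` this is AM-GM for `a` and `b / 4`. Summed over two probability laws, it turns an
affinity close to one into a lower bound on their overlap. -/
lemma sqrt_mul_le_min_add {a b : ℝ} (ha : 0 ≤ a) (hb : 0 ≤ b) :
    √(a * b) ≤ 3 / 4 * min a b + (a + b) / 4 := by
  refine Real.sqrt_le_iff.2 ⟨by positivity, ?_⟩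
  rcases le_total a b with h | h
  · rw [min_eq_left h]; nlinarith [sq_nonneg (a - b / 4)]
  · rw [min_eq_right h]; nlinarith [sq_nonneg (b - a / 4)]

/-- Product measures which differ in `N` factors at squared Hellinger distance `ρ`, with
`N ρ ≤ 1 / 4`, have overlap at least one half. -/
lemma half_le_sum_min_labelProb [Fintype Z] {T N : ℕ} (hN : N ≤ T) {q q' : Z → ℝ}
    (hq : q ∈ stdSimplex ℝ Z) (hq' : q' ∈ stdSimplex ℝ Z)
    (hNρ : N * hellingerSq q q' ≤ 1 / 4) :
    1 / 2 ≤ ∑ z : Fin T → Z, min (labelProb (fun _ _ => q) z)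
      (labelProb (fun t _ => if t < N then q' else q) z) := by
  set p₂ : NoiseSelector Z := fun t _ => if t < N then q' else q with hp₂
  have hp₂m : ∀ t zs, p₂ t zs ∈ stdSimplex ℝ Z := fun t zs => by
    simp only [hp₂]; split_ifs <;> assumption
  set ρ := hellingerSq q q' with hρ
  have hρeq := hellingerSq_eq hq hq'
  have haff : ∑ m, √(q m * q' m) = 1 - ρ / 2 := by rw [hρ, hρeq]; ring
  have hself : ∑ m, √(q m * q m) = 1 := by
    rw [← hq.2]
    exact Finset.sum_congr rfl fun m _ => Real.sqrt_mul_self (hq.1 m)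
  have h1 : ∀ z : Fin T → Z, 0 ≤ labelProb (fun _ _ => q) z :=
    labelProb_nonneg fun t _ zs m => hq.1 m
  have h2 : ∀ z : Fin T → Z, 0 ≤ labelProb p₂ z :=
    labelProb_nonneg fun t _ zs m => (hp₂m t zs).1 m
  have hprod : ∑ z : Fin T → Z, √(labelProb (fun _ _ => q) z * labelProb p₂ z) =
      (1 - ρ / 2) ^ N := by
    have e1 : ∀ z : Fin T → Z, √(labelProb (fun _ _ => q) z * labelProb p₂ z) =
        ∏ t : Fin T, √(q (z t) * (if (t : ℕ) < N then q' else q) (z t)) := fun z => by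
      rw [labelProb, labelProb, ← Finset.prod_mul_distrib, Real.sqrt_prod]
      exact fun t _ => mul_nonneg (hq.1 _) ((hp₂m t (pastLabels z t t.isLt.le)).1 _)
    simp only [e1]
    have e2 := Finset.prod_univ_sum (fun _ : Fin T => (Finset.univ : Finset Z))
      fun t m => √(q m * (if (t : ℕ) < N then q' else q) m)
    rw [Fintype.piFinset_univ] at e2
    rw [← e2]
    have e3 : ∀ t : Fin T, ∑ m, √(q m * (if (t : ℕ) < N then q' else q) m) =
        if (t : ℕ) < N then 1 - ρ / 2 else 1 := fun t => by
      split_ifs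
      exacts [haff, hself]
    simp only [e3]
    rw [← Finset.prod_range (fun t => if t < N then 1 - ρ / 2 else 1), ← Finset.prod_filter,
      Finset.prod_const]
    congr 1
    have : (Finset.range T).filter (fun t => t < N) = Finset.range N := by
      ext i; simp only [Finset.mem_range, Finset.mem_filter]; omega
    rw [this, Finset.card_range]
  have hle := Finset.sum_le_sum fun z (_ : z ∈ Finset.univ) => sqrt_mul_le_min_add (h1 z) (h2 z)
  rw [hprod, Finset.sum_add_distrib, ← Finset.mul_sum, ← Finset.sum_div, Finset.sum_add_distrib,
    sum_labelProb_eq_one fun _ _ _ => hq.2, sum_labelProb_eq_one fun t _ zs => (hp₂m t zs).2] at hle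
  -- Bernoulli bounds the affinity below by `1 - N * ρ / 2 ≥ 7 / 8`, and `(7 / 8 - 1 / 2) * 4 / 3 =
  -- 1 / 2`.
  have hbern : 1 + (N : ℝ) * (-(ρ / 2)) ≤ (1 + -(ρ / 2)) ^ N := by
    refine one_add_mul_le_pow ?_ N
    have : 0 ≤ ∑ m, √(q m * q' m) := Finset.sum_nonneg fun m _ => Real.sqrt_nonneg _
    linarith
  rw [← sub_eq_add_neg] at hbern
  linarith

/-! ### Hard features compatible with the soft constraint -/

lemma hellingerSq_comm [Fintype Z] (p q : Z → ℝ) : hellingerSq p q = hellingerSq q p :=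
  Finset.sum_congr rfl fun m _ => by ring

lemma hellingerSq_le_two_mul_add [Fintype Z] (p q s : Z → ℝ) :
    hellingerSq p q ≤ 2 * hellingerSq p s + 2 * hellingerSq s q := by
  simp only [hellingerSq, Finset.mul_sum, ← Finset.sum_add_distrib]
  exact Finset.sum_le_sum fun m _ => by nlinarith [sq_nonneg (√(p m) + √(q m) - 2 * √(s m))]

lemma exists_hellingerSq_eq [Fintype Z] {p q : Z → ℝ} (hp : p ∈ stdSimplex ℝ Z)
    (hq : q ∈ stdSimplex ℝ Z) {ρ : ℝ} (hρ : 0 ≤ ρ) (h : ρ ≤ hellingerSq p q) :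
    ∃ s ∈ stdSimplex ℝ Z, hellingerSq p s = ρ := by
  have hc : ContinuousOn (fun t : ℝ => hellingerSq p (p + t • (q - p))) (Set.Icc 0 1) := by
    unfold hellingerSq
    simp only [Pi.add_apply, Pi.smul_apply, Pi.sub_apply, smul_eq_mul]
    fun_prop
  have := intermediate_value_Icc zero_le_one hc
  obtain ⟨t, ht, hte⟩ := this (a := ρ) ⟨by simpa [hellingerSq] using hρ, by simpa using h⟩
  exact ⟨_, (convex_stdSimplex ℝ Z).add_smul_sub_mem hp hq ht, hte⟩

lemma le_gap [Fintype Z] {𝒦 : NoisyKernel X Y Z} {x : X} {r : ℝ}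
    (h : ∀ y y', y ≠ y' → ∀ p ∈ 𝒦.Q x y, ∀ q ∈ 𝒦.Q x y', r ≤ hellingerSq p q) :
    ENNReal.ofReal r ≤ 𝒦.gap x :=
  le_iInf fun y => le_iInf fun y' => le_iInf fun hy => le_iInf₂ fun p hp => le_iInf₂ fun q hq =>
    ENNReal.ofReal_le_ofReal (h y y' hy p hp q hq)

lemma le_hellingerSq_of_le_gap [Fintype Z] {𝒦 : NoisyKernel X Y Z} {x : X} {r : ℝ}
    (h : ENNReal.ofReal r ≤ 𝒦.gap x) {y y' : Y} (hy : y ≠ y') {p q : Z → ℝ} (hp : p ∈ 𝒦.Q x y)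
    (hq : q ∈ 𝒦.Q x y') : r ≤ hellingerSq p q :=
  (ENNReal.ofReal_le_ofReal_iff (Finset.sum_nonneg fun _ _ => sq_nonneg _)).1 <|
    h.trans (iInf_le_of_le y <| iInf_le_of_le y' <| iInf_le_of_le hy <|
      iInf₂_le_of_le p hp <| iInf₂_le_of_le q hq le_rfl)

open Classical in
/-- The kernel `𝒦` at `x₁`, copied to all features except `x₀`, where the label `y` has the single
noise distribution `s y`. -/
def NoisyKernel.withHardFeature [Fintype Z] (𝒦 : NoisyKernel X Y Z) (x₁ x₀ : X) (s : Y → Z → ℝ)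
    (hs : ∀ y, s y ∈ stdSimplex ℝ Z) : NoisyKernel X Y Z where
  Q x y := if x = x₀ then {s y} else 𝒦.Q x₁ y
  subset_simplex x y := by
    split_ifs
    exacts [Set.singleton_subset_iff.2 (hs y), 𝒦.subset_simplex _ _]
  nonempty x y := by
    split_ifs
    exacts [Set.singleton_nonempty _, 𝒦.nonempty _ _]
  convex x y := by
    split_ifs
    exacts [convex_singleton _, 𝒦.convex _ _]
  closed x y := by
    split_ifs
    exacts [isClosed_singleton, 𝒦.closed _ _]

/-- The selector that presents `x₀` in the first `N` rounds and `x₁` afterwards. -/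
def switchSelector (Z : Type*) (N : ℕ) (x₀ x₁ : X) : FeatureSelector X Z :=
  fun t _ => if t < N then x₀ else x₁

/-- At levels `r` reaching the gap of `x₁` the constraint is vacuous by `hgood`. Below them only the
`N` rounds at `x₀` can count, and only for `r ≥ ρ`. -/
lemma softGap_switchSelector [Fintype Z] [Nonempty Z] {A α ρ : ℝ} (hA : 0 < A)
    (hβ : 0 ≤ α / (1 - α)) (hρ : 0 ≤ ρ) {T N : ℕ} (hT : 1 ≤ T) {𝒦 : NoisyKernel X Y Z}
    {x₀ x₁ : X} (h₀ : ENNReal.ofReal ρ ≤ 𝒦.gap x₀)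
    (hN : (N : ℝ) ≤ A * T * ρ ^ (α / (1 - α)))
    (hgood : ∀ r : ℝ, 0 < r → r ≤ 1 / 2 → 𝒦.gap x₁ ≤ ENNReal.ofReal r →
      1 ≤ A * r ^ (α / (1 - α))) :
    SoftGap A α T 𝒦 (switchSelector Z N x₀ x₁) := by
  classical
  intro r hr hr2
  have hT0 : (0 : ℝ) < T := by exact_mod_cast hT
  have hinf : ∀ t, (⨅ zs : Fin t → Z, 𝒦.gap (switchSelector Z N x₀ x₁ t zs)) =
      if t < N then 𝒦.gap x₀ else 𝒦.gap x₁ := fun t => by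
    simp only [switchSelector, iInf_const, apply_ite 𝒦.gap]
  simp only [hinf]
  rw [one_div, inv_mul_le_iff₀ hT0]
  by_cases hr1 : 𝒦.gap x₁ ≤ ENNReal.ofReal r
  · calc _ ≤ ∑ t ∈ Finset.range T, (1 : ℝ) :=
          Finset.sum_le_sum fun t _ => by split_ifs <;> norm_num
      _ = T * 1 := by simp
      _ ≤ _ := mul_le_mul_of_nonneg_left (hgood r hr hr2 hr1) hT0.le
  · rcases lt_or_ge r ρ with hlt | hge
    · have hlt' : ENNReal.ofReal r < ENNReal.ofReal ρ :=
        (ENNReal.ofReal_lt_ofReal_iff (hr.trans hlt)).2 hlt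
      have hr0 : ¬ 𝒦.gap x₀ ≤ ENNReal.ofReal r := not_le.2 (hlt'.trans_le h₀)
      calc _ ≤ ∑ t ∈ Finset.range T, (0 : ℝ) :=
            Finset.sum_le_sum fun t _ => by split_ifs <;> simp_all
        _ ≤ _ := by rw [Finset.sum_const_zero]; positivity
    · calc _ ≤ ∑ t ∈ Finset.range T, if t < N then (1 : ℝ) else 0 :=
            Finset.sum_le_sum fun t _ => by split_ifs <;> simp_all
        _ ≤ N := by
            rw [Finset.sum_boole]
            have : (Finset.range T).filter (fun t => t < N) ⊆ Finset.range N := fun i hi =>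
              Finset.mem_range.2 (Finset.mem_filter.1 hi).2
            exact_mod_cast (Finset.card_le_card this).trans (Finset.card_range N).le
        _ ≤ A * T * ρ ^ (α / (1 - α)) := hN
        _ ≤ A * T * r ^ (α / (1 - α)) :=
            mul_le_mul_of_nonneg_left (Real.rpow_le_rpow hρ hge hβ) (by positivity)
        _ = _ := by ring

/-- `N` rounds at a feature with Hellinger gap `ρ`, where `N ρ ≤ 1 / 4`, cost `N / 4`. -/
lemma quarter_le_softWorstRisk [Fintype Y] [Fintype Z] [Nontrivial Y] [Nonempty Z] {A α ρ : ℝ}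
    (hA : 0 < A) (hβ : 0 ≤ α / (1 - α)) (hρ : 0 ≤ ρ) {T N K : ℕ} (hT : 1 ≤ T) (hNT : N ≤ T)
    (hK : 2 ≤ K) {𝒦 : NoisyKernel X Y Z} {x₀ x₁ : X} (hx : x₀ ≠ x₁)
    (hgap : ENNReal.ofReal (4 * ρ) ≤ 𝒦.gap x₁)
    (hN : (N : ℝ) ≤ A * T * ρ ^ (α / (1 - α))) (hNρ : N * ρ ≤ 1 / 4)
    (hgood : ∀ r : ℝ, 0 < r → r ≤ 1 / 2 → 𝒦.gap x₁ ≤ ENNReal.ofReal r →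
      1 ≤ A * r ^ (α / (1 - α))) :
    ENNReal.ofReal (N / 4) ≤ softWorstRisk X Y Z A α T K := by
  classical
  obtain ⟨a, b, hab⟩ := exists_pair_ne Y
  choose q hq using 𝒦.nonempty x₁
  have hqs : ∀ y, q y ∈ stdSimplex ℝ Z := fun y => 𝒦.subset_simplex _ _ (hq y)
  have hqd : ∀ y y', y ≠ y' → 4 * ρ ≤ hellingerSq (q y) (q y') := fun y y' hy =>
    le_hellingerSq_of_le_gap hgap hy (hq y) (hq y')
  -- Sliding from `q a` towards `q b` makes these two labels hard to tell apart. The factor four in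
  -- `hgap` pays for the weak triangle inequality, which keeps `p` at distance at least `ρ` from the
  -- laws of all other labels.
  obtain ⟨p, hp, hpρ⟩ := exists_hellingerSq_eq (hqs a) (hqs b) hρ (by linarith [hqd a b hab])
  have hpd : ∀ y, y ≠ b → ρ ≤ hellingerSq (q y) p := fun y hy => by
    by_cases hya : y = a
    · rw [hya, hpρ]
    · have h1 := hqd y a hya
      have h2 := hellingerSq_le_two_mul_add (q y) (q a) p
      rw [hellingerSq_comm p, hpρ] at h2
      linarith
  set s : Y → Z → ℝ := fun y => if y = b then p else q y with hsdef
  have hss : ∀ y, s y ∈ stdSimplex ℝ Z := fun y => by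
    simp only [hsdef]; split_ifs; exacts [hp, hqs y]
  have hsd : ∀ y y', y ≠ y' → ρ ≤ hellingerSq (s y) (s y') := fun y y' hy => by
    simp only [hsdef]
    split_ifs with h1 h2 h2
    · exact absurd (h1.trans h2.symm) hy
    · rw [hellingerSq_comm]; exact hpd y' h2
    · exact hpd y h1
    · linarith [hqd y y' hy]
  set 𝒦' := 𝒦.withHardFeature x₁ x₀ s hss with h𝒦'
  have hQ₀ : ∀ y, 𝒦'.Q x₀ y = {s y} := fun y => if_pos rfl
  have hQ₁ : ∀ y, 𝒦'.Q x₁ y = 𝒦.Q x₁ y := fun y => if_neg hx.symm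
  have hg₁ : 𝒦'.gap x₁ = 𝒦.gap x₁ := by simp only [NoisyKernel.gap, hQ₁]
  have hg₀ : ENNReal.ofReal ρ ≤ 𝒦'.gap x₀ := le_gap fun y y' hy u hu u' hu' => by
    rw [hQ₀, Set.mem_singleton_iff] at hu hu'
    rw [hu, hu']
    exact hsd y y' hy
  have hsoft := softGap_switchSelector (T := T) hA hβ hρ hT hg₀ hN (hg₁ ▸ hgood)
  have hadm₁ : IsAdmissibleNoise 𝒦' T (fun _ => a) (switchSelector Z N x₀ x₁) fun _ _ => q a := by
    intro t _ zs
    by_cases h : t < N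
    · simp only [switchSelector, if_pos h, hQ₀, Set.mem_singleton_iff, hsdef, if_neg hab]
    · simp only [switchSelector, if_neg h, hQ₁, hq]
  have hadm₂ : IsAdmissibleNoise 𝒦' T (fun x => if x = x₀ then b else a)
      (switchSelector Z N x₀ x₁) fun t _ => if t < N then p else q a := by
    intro t _ zs
    by_cases h : t < N
    · simp only [switchSelector, if_pos h, if_true, hQ₀, Set.mem_singleton_iff, hsdef]
    · simp only [switchSelector, if_neg h, if_neg hx.symm, hQ₁, hq]
  refine le_softWorstRisk_of_two_hypotheses hK hsoft hadm₁ hadm₂ fun Φ => ?_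
  have h1 := sum_min_le_expectedErrors_add hNT (fun t ht zs => by
    simp only [switchSelector, if_pos ht, if_true]; exact hab) hadm₁ hadm₂ Φ
  have h2 := half_le_sum_min_labelProb (T := T) hNT (hqs a) hp (by rw [hpρ]; exact hNρ)
  have h3 := mul_le_mul_of_nonneg_left h2 (Nat.cast_nonneg (α := ℝ) N)
  linarith

lemma exists_hard_gap {A α : ℝ} (hA : 0 < A) (hα₀ : 0 ≤ α) (hα₁ : α < 1) :
    ∃ a : ℝ, 0 < a ∧ a ≤ 1 ∧ ∀ T : ℕ, 1 ≤ T → ∃ ρ : ℝ, 0 ≤ ρ ∧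
      a * (T : ℝ) ^ (1 - α) ≤ A * T * ρ ^ (α / (1 - α)) ∧ a * (T : ℝ) ^ (1 - α) * ρ ≤ 1 / 4 ∧
      (ρ = 0 ∨ 4 * ρ ≤ 1 / 2 ∧ A * (4 * ρ) ^ (α / (1 - α)) < 1) := by
  rcases hα₀.eq_or_lt with rfl | hα
  -- For `α = 0` the exponent vanishes and `0 ^ 0 = 1`, so a proportion `A` of the rounds may have
  -- gap zero.
  · refine ⟨min 1 A, lt_min one_pos hA, min_le_left _ _, fun T _ => ⟨0, le_rfl, ?_, by simp,
      Or.inl rfl⟩⟩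
    simp only [sub_zero, Real.rpow_one, zero_div, Real.rpow_zero, mul_one]
    exact mul_le_mul_of_nonneg_right (min_le_right _ _) (Nat.cast_nonneg T)
  · set β := α / (1 - α) with hβdef
    have hβ : 0 < β := div_pos hα (by linarith)
    -- With `A * γ ^ β < 1` the soft constraint is not vacuous at level `4 * ρ ≤ γ`, which will
    -- force a feature of gap above `4 * ρ`.
    set γ : ℝ := min (1 / 2) ((1 / (2 * A)) ^ (1 / β)) with hγdef
    have hγ : 0 < γ := lt_min (by norm_num) (by positivity)
    have hγ2 : γ ≤ 1 / 2 := min_le_left _ _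
    have hγA : A * γ ^ β < 1 := by
      have h1 : γ ^ β ≤ 1 / (2 * A) := by
        refine (Real.rpow_le_rpow hγ.le (min_le_right _ _) hβ.le).trans (le_of_eq ?_)
        rw [← Real.rpow_mul (by positivity), one_div_mul_cancel hβ.ne', Real.rpow_one]
      have h2 := mul_le_mul_of_nonneg_left h1 hA.le
      have h3 : A * (1 / (2 * A)) = 1 / 2 := by field_simp
      linarith
    refine ⟨min 1 (A * (γ / 4) ^ β), lt_min one_pos (by positivity), min_le_left _ _,
      fun T hT => ?_⟩
    have hT1 : (1 : ℝ) ≤ T := by exact_mod_cast hT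
    have hT0 : (0 : ℝ) < T := by linarith
    have hV : (T : ℝ) ^ (-(1 - α)) ≤ 1 := Real.rpow_le_one_of_one_le_of_nonpos hT1 (by linarith)
    have hV0 : 0 < (T : ℝ) ^ (-(1 - α)) := Real.rpow_pos_of_pos hT0 _
    have hUV : (T : ℝ) ^ (1 - α) * (T : ℝ) ^ (-(1 - α)) = 1 := by
      rw [← Real.rpow_add hT0, add_neg_cancel, Real.rpow_zero]
    have hU0 : 0 < (T : ℝ) ^ (1 - α) := Real.rpow_pos_of_pos hT0 _
    refine ⟨γ / 4 * (T : ℝ) ^ (-(1 - α)), by positivity, ?_, ?_, Or.inr ?_⟩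
    · rw [Real.mul_rpow (by positivity) hV0.le, ← Real.rpow_mul hT0.le]
      have h1 : -(1 - α) * β = -α := by
        have : 1 - α ≠ 0 := by linarith
        rw [hβdef]; field_simp
      have h2 : (T : ℝ) ^ (1 - α) = T * (T : ℝ) ^ (-α) := by
        rw [sub_eq_add_neg, Real.rpow_add hT0, Real.rpow_one]
      rw [h1]
      calc _ ≤ A * (γ / 4) ^ β * (T : ℝ) ^ (1 - α) :=
            mul_le_mul_of_nonneg_right (min_le_right _ _) hU0.le
        _ = _ := by rw [h2]; ring
    · calc _ ≤ 1 * (T : ℝ) ^ (1 - α) * (γ / 4 * (T : ℝ) ^ (-(1 - α))) := by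
            refine mul_le_mul_of_nonneg_right ?_ (by positivity)
            exact mul_le_mul_of_nonneg_right (min_le_left _ _) hU0.le
        _ = γ / 4 * ((T : ℝ) ^ (1 - α) * (T : ℝ) ^ (-(1 - α))) := by ring
        _ ≤ 1 / 4 := by rw [hUV]; linarith
    · have h4 : 4 * (γ / 4 * (T : ℝ) ^ (-(1 - α))) ≤ γ := by nlinarith
      refine ⟨h4.trans hγ2, lt_of_le_of_lt ?_ hγA⟩
      exact mul_le_mul_of_nonneg_left (Real.rpow_le_rpow (by positivity) h4 hβ.le) hA.le

/-- Take a feature from a round whose least gap is maximal: if its gap is at most `r`, every round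
counts at level `r`, and the constraint reads `1 ≤ A * r ^ (α / (1 - α))`. -/
lemma SoftGap.exists_good_feature [Fintype Z] [Nonempty Z] {A α : ℝ} {T : ℕ} (hT : 1 ≤ T)
    {𝒦 : NoisyKernel X Y Z} {ψ : FeatureSelector X Z} (hψ : SoftGap A α T 𝒦 ψ) :
    ∃ x, ∀ r : ℝ, 0 < r → r ≤ 1 / 2 → 𝒦.gap x ≤ ENNReal.ofReal r →
      1 ≤ A * r ^ (α / (1 - α)) := by
  have hT0 : (0 : ℝ) < T := by exact_mod_cast hT
  obtain ⟨t, _, ht⟩ := Finset.exists_max_image (Finset.range T)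
    (fun t => ⨅ zs : Fin t → Z, 𝒦.gap (ψ t zs)) ⟨0, Finset.mem_range.2 hT⟩
  refine ⟨ψ t fun _ => Classical.arbitrary Z, fun r hr hr2 hle => ?_⟩
  have h := hψ r hr hr2
  rw [Finset.sum_congr rfl fun s hs => if_pos (((ht s hs).trans (iInf_le _ _)).trans hle)] at h
  simpa [hT0.ne'] using h

theorem exists_le_softWorstRisk {A α : ℝ} (hA : 0 < A) (hα₀ : 0 ≤ α) (hα₁ : α < 1) :
    ∃ c : ℝ, 0 < c ∧ ∀ (X : Type u) (Y : Type v) (Z : Type w) [Fintype Y] [Fintype Z]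
      [Nontrivial Y] [Nontrivial X] [Nonempty Z] (T K : ℕ), 1 ≤ T → 2 ≤ K →
      (softKernels X Y Z A α T).Nonempty →
      ENNReal.ofReal (c * (T : ℝ) ^ (1 - α)) ≤ softWorstRisk X Y Z A α T K := by
  obtain ⟨a, ha0, ha1, ha⟩ := exists_hard_gap hA hα₀ hα₁
  refine ⟨a / 8, by positivity, fun X Y Z _ _ _ _ _ T K hT hK hne => ?_⟩
  obtain ⟨ρ, hρ, hN, hNρ, hcase⟩ := ha T hT
  have hT1 : (1 : ℝ) ≤ T := by exact_mod_cast hT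
  set U : ℝ := (T : ℝ) ^ (1 - α) with hU
  have hU0 : 0 < U := by positivity
  have hUT : U ≤ T := by
    simpa using Real.rpow_le_rpow_of_exponent_le hT1 (by linarith : 1 - α ≤ 1)
  set N : ℕ := ⌊a * U⌋₊ with hNdef
  have hNle : (N : ℝ) ≤ a * U := Nat.floor_le (by positivity)
  have hNlt : a * U < N + 1 := Nat.lt_floor_add_one _
  -- If the floor is zero, then `a * U < 1` and the first prediction alone suffices; otherwise `N ≥
  -- a * U / 2`, hence the constant `a / 8`.
  rcases Nat.eq_zero_or_pos N with h0 | hpos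
  · refine le_trans (ENNReal.ofReal_le_ofReal ?_) (half_le_softWorstRisk hT hK hne)
    rw [h0] at hNlt
    push_cast at hNlt
    linarith
  · obtain ⟨𝒦, ψ, hψ⟩ := hne
    obtain ⟨x₁, hx₁⟩ := hψ.exists_good_feature hT
    obtain ⟨x₀, hx₀⟩ := exists_ne x₁
    have hgap : ENNReal.ofReal (4 * ρ) ≤ 𝒦.gap x₁ := by
      rcases hρ.eq_or_lt with h | h
      · simp [← h]
      · rcases hcase with h' | ⟨h1, h2⟩
        · exact absurd h' h.ne'
        · by_contra hlt
          exact absurd (hx₁ (4 * ρ) (by linarith) h1 (not_le.1 hlt).le) (not_le.2 h2)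
    have hNT : N ≤ T := by
      have : (N : ℝ) ≤ T := hNle.trans ((mul_le_of_le_one_left hU0.le ha1).trans hUT)
      exact_mod_cast this
    have hmain := quarter_le_softWorstRisk hA (div_nonneg hα₀ (by linarith)) hρ hT hNT hK hx₀
      hgap (hNle.trans hN) ((mul_le_mul_of_nonneg_right hNle hρ).trans hNρ) hx₁
    refine le_trans (ENNReal.ofReal_le_ofReal ?_) hmain
    have : (1 : ℝ) ≤ N := by exact_mod_cast hpos
    linarith

end LowerBound

theorem mainTheorem8 (A α : ℝ) (hA : 0 < A) (hα₀ : 0 ≤ α) (hα₁ : α < 1) :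
    ∃ (c C : ℝ) (d : ℕ), 0 < c ∧ 0 < C ∧
      ∀ (X : Type u) (Y : Type v) (Z : Type w) [Fintype Y] [Fintype Z] [Nontrivial Y] [Nontrivial Z]
        (T K : ℕ), 1 ≤ T → 2 ≤ K →
        softWorstRisk X Y Z A α T K ≤
            ENNReal.ofReal (C * ((1 + Real.log T) * (1 + Real.log K)) ^ d * (T : ℝ) ^ (1 - α)) ∧
        (Nontrivial X → (softKernels X Y Z A α T).Nonempty →
          ENNReal.ofReal (c * (T : ℝ) ^ (1 - α) / ((1 + Real.log T) * (1 + Real.log K)) ^ d) ≤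
            softWorstRisk X Y Z A α T K) := by
  obtain ⟨c, hc, hlow⟩ := exists_le_softWorstRisk.{u, v, w} hA hα₀ hα₁
  -- The lower bound holds without logarithms; the exponent two is needed only for the upper bound.
  refine ⟨c, A + 34, 2, hc, by linarith, fun X Y Z _ _ _ _ T K hT hK =>
    ⟨softWorstRisk_le hA hα₀ hα₁ hT hK, fun _ hne =>
      le_trans (ENNReal.ofReal_le_ofReal ?_) (hlow X Y Z T K hT hK hne)⟩⟩
  have hlogT : 0 ≤ Real.log T := Real.log_natCast_nonneg T
  have hlogK : 0 ≤ Real.log K := Real.log_natCast_nonneg K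
  refine div_le_self (by positivity) (one_le_pow₀ ?_)
  nlinarith [mul_nonneg hlogT hlogK]
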